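/- **Notation.** For $n\ge 1$ let $W_n=\mathrm{Aut}(T_n)$ be the automorphism group of the complete binary rooted tree of height $n$, acting on its $2^n$ leaves $1,\dots,2^n$, numbered from left to right. Permutations are composed from right to left, $g^w=wgw^{-1}$, and for $i\le n$ we regard $W_i\le W_n$ by letting $W_i$ act on the leaves $1,\dots,2^i$ and fix all other leaves. Let $a_k=\prod_{j=1}^{2^{k-1}}(j,\,j+2^{k-1})$ and $x_k=a_1a_2\cdots a_k$. An $n$-odometer is an element $w\in W_n$ such that $\langle w\rangle$ is transitive on the leaves, and for $G\le W_n$ we put $G^{od}=\{g\in G: x_ng\text{ is an }n\text{-odometer}\}$. **The groups.** Let $m_1=\mathrm{id}\in W_1$ and $m_2=(1,2)\in W_2$, where the cycles $(1,2),(3),(4)$ of $m_2$ carry the types $sn,ss,ss$. The element $m_{n+1}$ is obtained from $m_n$ ($n\ge 2$) by replacing each typed cycle $(c_1,\dots,c_k)$ as follows. Type $nn$: one cycle $(2c_1-1,\dots,2c_k-1,2c_1,\dots,2c_k)$ of type $nn$. Type $ns$: the same cycle with type $sn$. Type $sn$: the cycles $(2c_1-1,\dots,2c_k-1)$ of type $nn$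 and $(2c_1,\dots,2c_k)$ of type $sn$. Type $ss$: the same two cycles, both of type $ss$. (Cycles are written starting from their smallest entry.) In $W_n$ put $$M_n=\langle x_n,m_n,x_{n-1}^2,\dots,x_2^2\rangle,\qquad H_n=\langle m_n,x_{n-1}^2,\dots,x_2^2\rangle$$ (for $n\le 2$ there are no $x_i^2$), let $N_n$ be the normal closure of $H_n$ in $M_n$, and let $$M_n(2)=\langle x_n^2,\;x_nm_n,\;N_n^{od}\rangle .$$ **The model.** Let $h_a(x)=(x+a)^2-a-1\in\mathbb Z[x]$ be irreducible with $a=\pm b^2$ for some $b\in\mathbb Z$. The post-critical orbit of $h_a$ is $(-a-1,-a)$, and its critical point is periodic. Model 6, the even Markov model of $h_a$, is the following. Its level $1$ data are $$([sn,2],\tfrac12),\ ([nn,1][nn,1],\tfrac18),\ ([ns,1][ns,1],\tfrac18),\ ([sn,1][sn,1],\tfrac18),\ ([ss,1][ss,1],\tfrac18).$$ Its level $n+1$ data arise from its level $n$ data by one step of the Markov process of $h_a$, in which the factors $[T,d]$ of a formal product evolve independently of each other: a factor whose type $T$ starts with $n$ becomes $[h_a(T),2d]$, where $h_a(T)$ is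 the type $T$ with its two letters exchanged; a factor whose type $T$ starts with $s$ becomes $[T_1,d][T_2,d]$, where all pairs of types with $T_1T_2=h_a(T)$ (entrywise product, with $s$ as the identity and $n\cdot n=s$) and with equal last letters are equiprobable. Explicitly, $$[nn,d]\to[nn,2d],\qquad [ns,d]\to[sn,2d],$$ $$[sn,d]\to[ns,d][ss,d]\ \text{or}\ [nn,d][sn,d],$$ $$[ss,d]\to[nn,d]^2\ \text{or}\ [ns,d]^2\ \text{or}\ [sn,d]^2\ \text{or}\ [ss,d]^2 .$$ **Corollary 6.28.** For every $n\ge1$, $M_n(2)$ is a subgroup of $\mathrm{Aut}(T_n)$ that satisfies Model 6: for every partition $c$ of $2^n$, the proportion of elements of $M_n(2)$ with cycle type $c$ (including $1$-cycles) equals the sum of the densities of the level $n$ data whose multiset of degrees is $c$. -/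

import Mathlib

namespace MarkovModel

open Polynomial

/-! ## Types of factors and the Markov process of a quadratic polynomial -/

/-- The two letters of types: `s` for "square", `n` for "not a square". -/
inductive Letter
  | n
  | s
  deriving DecidableEq

namespace Letter

/-- Multiplication of quadratic characters. -/
def mul : Letter → Letter → Letter
  | s, b => b
  | n, n => s
  | n, s => n

end Letter

open Letter

/-- A type: a string of letters (its length is the size of the post-critical orbit). -/
abbrev Typ := List Letter

/-- All types of a given length. -/
def allTypes : ℕ → List Typ
  | 0 => [[]]
  | o + 1 => (allTypes o).flatMap fun T => [n :: T, s :: T]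

/-- Entrywise product of types. -/
def mulTyp (T₁ T₂ : Typ) : Typ := List.zipWith Letter.mul T₁ T₂

/-- The `i`-th digit of a type; digits are numbered `1, 2, …`. -/
def digit (T : Typ) (i : ℕ) : Letter := T.getD (i - 1) s

/-- The critical point of a quadratic polynomial. -/
noncomputable def criticalPoint (f : ℤ[X]) : ℚ := -(f.coeff 1 : ℚ) / (2 * (f.coeff 2 : ℚ))

/-- `f^k(c)`, where `c` is the critical point of `f`. -/
noncomputable def criticalIterate (f : ℤ[X]) (k : ℕ) : ℚ :=
  (fun y : ℚ => aeval y f)^[k] (criticalPoint f)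

/-- The post-critical orbit `{f(c), f²(c), …}`. -/
def postCriticalOrbit (f : ℤ[X]) : Set ℚ := {y | ∃ k, 1 ≤ k ∧ y = criticalIterate f k}

/-- The tail of the post-critical orbit: the points that are visited exactly once. -/
def postCriticalTail (f : ℤ[X]) : Set ℚ :=
  {y | ∃ k, 1 ≤ k ∧ y = criticalIterate f k ∧
    ∀ i, i ≠ k → criticalIterate f i ≠ criticalIterate f k}

/-- The number `o`: the size of the post-critical orbit. -/
noncomputable def orbitSize (f : ℤ[X]) : ℕ := (postCriticalOrbit f).ncard

/-- The number `t`: the size of the tail; the critical point is periodic iff `t = 0`. -/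
noncomputable def tailSize (f : ℤ[X]) : ℕ := (postCriticalTail f).ncard

/-- The integer `m ∈ {1, …, o}` with `f^(o+1)(c) = f^m(c)`. -/
noncomputable def returnIndex (f : ℤ[X]) : ℕ :=
  sInf {m | 1 ≤ m ∧ criticalIterate f (orbitSize f + 1) = criticalIterate f m}

/-- The action of `f` on types: shift one position to the left and append the `m`-th digit,
where `f^(o+1)(c) = f^m(c)`. -/
noncomputable def actTyp (f : ℤ[X]) (T : Typ) : Typ := T.tail ++ [digit T (returnIndex f)]

/-- The index `k` in the constraint on the types of two siblings: `k = o` if the critical point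
is periodic, and `k = t` otherwise. -/
noncomputable def siblingIndex (f : ℤ[X]) : ℕ :=
  if tailSize f = 0 then orbitSize f else tailSize f

/-- The allowable pairs of types of the two children of a factor of type `T`: the product of
the two types is `f(T)`, and, with `k` the sibling index, the last digit of each of the two types
is the `k`-th digit of the other. -/
noncomputable def allowablePairs (f : ℤ[X]) (T : Typ) : List (Typ × Typ) :=
  ((allTypes (orbitSize f)).product (allTypes (orbitSize f))).filter fun P =>
    mulTyp P.1 P.2 = actTyp f T ∧
    digit P.1 (orbitSize f) = digit P.2 (siblingIndex f) ∧
    digit P.2 (orbitSize f) = digit P.1 (siblingIndex f)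

/-- A formal product `∏ [tᵢ, dᵢ]`: a list of factors with their types and degrees. -/
abbrev FactorizationType := List (Typ × ℕ)

/-- A collection of data: factorization types, each with its density. -/
abbrev Data := List (FactorizationType × ℚ)

/-- The possible families of children of one factor (primes `≡ 1 mod 4`): one child of twice the
degree if the type starts with `n`, two children of the same degree with an allowable pair of
types if it starts with `s`. -/
noncomputable def childrenOptions (f : ℤ[X]) : Typ × ℕ → List FactorizationType
  | (n :: T, d) => [[(actTyp f (n :: T), 2 * d)]]
  | (s :: T, d) => (allowablePairs f (s :: T)).map fun P => [(P.1, d), (P.2, d)]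
  | ([], _) => []

/-- All possible families of children of one factor are equiprobable. -/
noncomputable def childrenData (f : ℤ[X]) (g : Typ × ℕ) : Data :=
  (childrenOptions f g).map fun C => (C, 1 / ((childrenOptions f g).length : ℚ))

/-- One step of the Markov process on a factorization type: the factors evolve independently. -/
noncomputable def stepType (f : ℤ[X]) : FactorizationType → Data
  | [] => [([], 1)]
  | g :: D => (childrenData f g).flatMap fun C =>
      (stepType f D).map fun E => (C.1 ++ E.1, C.2 * E.2)

/-- One step of the Markov process, from level `n` data to level `n + 1` data. -/
noncomputable def stepData (f : ℤ[X]) (A : Data) : Data :=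
  A.flatMap fun D => (stepType f D.1).map fun E => (E.1, D.2 * E.2)

/-- The level `n` data, `n ≥ 1`, obtained from level `1` data `A` by `n - 1` steps of the
Markov process. -/
noncomputable def levelData (f : ℤ[X]) (A : Data) (n : ℕ) : Data := (stepData f)^[n - 1] A

/-- The cycle type (multiset of degrees) of a factorization type. -/
def degrees (D : FactorizationType) : Multiset ℕ := (D.map Prod.snd : List ℕ)

/-- The cycle data of a collection of data: the density of the cycle type `c` is the sum of the
densities of all data with that cycle type. -/
def cycleDensity (A : Data) (c : Multiset ℕ) : ℚ :=
  ((A.filter fun D => degrees D.1 = c).map Prod.snd).sum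

/-! ## The automorphism group of the binary tree of height `n`, acting on its `2 ^ n` leaves

Leaves are numbered `0, …, 2 ^ n - 1` from left to right; the ancestor at height `j` above the
leaf `i` is determined by `i / 2 ^ j`. -/

/-- Permutations of the leaves. -/
abbrev LeafPerm (n : ℕ) := Equiv.Perm (Fin (2 ^ n))

/-- `W_n = Aut(T_n)`: the permutations of the leaves such that, for each height `j`, two leaves
have the same ancestor iff their images do. -/
def treeAut (n : ℕ) : Subgroup (LeafPerm n) where
  carrier := {g | ∀ (j : ℕ) (i i' : Fin (2 ^ n)),
    (g i : ℕ) / 2 ^ j = (g i' : ℕ) / 2 ^ j ↔ (i : ℕ) / 2 ^ j = (i' : ℕ) / 2 ^ j}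
  one_mem' := fun _ _ _ => Iff.rfl
  mul_mem' := fun {_ b} ha hb j i i' => (ha j (b i) (b i')).trans (hb j i i')
  inv_mem' := fun {a} ha j i i' => by
    have h := ha j (a⁻¹ i) (a⁻¹ i')
    simp only [← Equiv.Perm.mul_apply, mul_inv_cancel, Equiv.Perm.one_apply] at h
    exact h.symm

/-- The cycle type of a permutation of the leaves, including its `1`-cycles. -/
def cycleTypeFull {n : ℕ} (g : LeafPerm n) : Multiset ℕ := g.partition.parts

/-- The proportion of elements of `G` with cycle type `c`. -/
noncomputable def groupCycleDensity {n : ℕ} (G : Subgroup (LeafPerm n)) (c : Multiset ℕ) : ℚ :=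
  (Nat.card {g : LeafPerm n // g ∈ G ∧ cycleTypeFull g = c} : ℚ) / (Nat.card G : ℚ)

/-- `G ≤ Aut(T_n)`, and the cycle data of `G` are the level `n` cycle data of the even Markov
model of `f` with level `1` data `A`. -/
def SatisfiesEvenMarkovModel (f : ℤ[X]) (A : Data) (n : ℕ) (G : Subgroup (LeafPerm n)) : Prop :=
  G ≤ treeAut n ∧ ∀ c : Multiset ℕ, groupCycleDensity G c = cycleDensity (levelData f A n) c

/-- The underlying map of `a_k`, on all natural numbers. -/
def aFun (k i : ℕ) : ℕ :=
  if i < 2 ^ (k - 1) then i + 2 ^ (k - 1) else if i < 2 * 2 ^ (k - 1) then i - 2 ^ (k - 1) else i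

theorem aFun_aFun (k i : ℕ) : aFun k (aFun k i) = i := by
  unfold aFun
  split_ifs <;> omega

theorem aFun_lt {n k i : ℕ} (hk : 1 ≤ k) (hkn : k ≤ n) (hi : i < 2 ^ n) : aFun k i < 2 ^ n := by
  have h : 2 * 2 ^ (k - 1) ≤ 2 ^ n := by
    calc 2 * 2 ^ (k - 1) = 2 ^ (k - 1 + 1) := by ring
      _ ≤ 2 ^ n := Nat.pow_le_pow_right (by norm_num) (by omega)
  unfold aFun
  split_ifs <;> omega

/-- `a_k ∈ W_n`, for `1 ≤ k ≤ n`: it swaps the leaves `i` and `i + 2 ^ (k - 1)` for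
`0 ≤ i < 2 ^ (k - 1)` and fixes all other leaves. (It is the identity for other `k`.) -/
def a (n k : ℕ) : LeafPerm n :=
  if h : 1 ≤ k ∧ k ≤ n then
    { toFun := fun i => ⟨aFun k i, aFun_lt h.1 h.2 i.2⟩
      invFun := fun i => ⟨aFun k i, aFun_lt h.1 h.2 i.2⟩
      left_inv := fun i => Fin.ext (aFun_aFun k i)
      right_inv := fun i => Fin.ext (aFun_aFun k i) }
  else 1

/-- `x_k = a_1 a_2 ⋯ a_k`, as an element of `W_n` for `k ≤ n`. -/
def x (n k : ℕ) : LeafPerm n := ((List.range k).map fun i => a n (i + 1)).prod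

/-- An `n`-odometer: an element of `W_n` that generates a group acting transitively on the leaves
(hence on every level of `T_n`). -/
def IsOdometer {n : ℕ} (w : LeafPerm n) : Prop := w ∈ treeAut n ∧ ∀ i j, w.SameCycle i j

/-- `G^od = {g ∈ G | x_n g is an n-odometer}`. -/
def od {n : ℕ} (G : Subgroup (LeafPerm n)) : Set (LeafPerm n) :=
  {g | g ∈ G ∧ IsOdometer (x n n * g)}

/-! ## The element `m_n`, by the Markov map of a restricted Markov process -/

/-- The restricted Markov process: the types of the child (one entry) or of the two children (two
entries), for `nn → nn`, `ns → sn`, `sn → nn, sn`, `ss → ss, ss`. -/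
def restricted : Typ → List Typ
  | [n, n] => [[n, n]]
  | [n, s] => [[s, n]]
  | [s, n] => [[n, n], [s, n]]
  | [s, s] => [[s, s], [s, s]]
  | _ => []

/-- A cycle of leaves (written as a list) with a type attached. -/
abbrev TypedCycle (n : ℕ) := List (Fin (2 ^ n)) × Typ

/-- The left child of the leaf `i` of `T_n`, as a leaf of `T_{n+1}`. -/
def leftChild {n : ℕ} (i : Fin (2 ^ n)) : Fin (2 ^ (n + 1)) :=
  ⟨2 * i, by have := i.2; rw [pow_succ]; omega⟩

/-- The right child of the leaf `i` of `T_n`, as a leaf of `T_{n+1}`. -/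
def rightChild {n : ℕ} (i : Fin (2 ^ n)) : Fin (2 ^ (n + 1)) :=
  ⟨2 * i + 1, by have := i.2; rw [pow_succ]; omega⟩

/-- The Markov map on one typed cycle `c`: the standard doubling
`(left c₁, …, left c_k, right c₁, …, right c_k)` if there is one child, and the standard splitting
`(left c₁, …, left c_k)(right c₁, …, right c_k)` if there are two. -/
def markovMapCycle {n : ℕ} (c : TypedCycle n) : List (TypedCycle (n + 1)) :=
  match restricted c.2 with
  | [T] => [(c.1.map leftChild ++ c.1.map rightChild, T)]
  | [T₁, T₂] => [(c.1.map leftChild, T₁), (c.1.map rightChild, T₂)]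
  | _ => []

/-- The typed cycle decomposition of `m_{k+2}`: the Markov map applied `k` times to
`m_2 = (0 1)(2)(3)` with the types `[sn,2][ss,1][ss,1]`. -/
def mCycles : (k : ℕ) → List (TypedCycle (k + 2))
  | 0 => [([(0 : Fin 4), (1 : Fin 4)], [s, n]), ([(2 : Fin 4)], [s, s]), ([(3 : Fin 4)], [s, s])]
  | k + 1 => (mCycles k).flatMap markovMapCycle

/-- The element `m_n` of `W_n`; `m_1` is the identity. -/
def m : (n : ℕ) → LeafPerm n
  | 0 => 1
  | 1 => 1
  | k + 2 => ((mCycles k).map fun c => c.1.formPerm).prod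

/-! ## The groups -/

/-- `{v_0, …, v_{n-3}} = {x_2², …, x_{n-1}²}`, in `W_n` (empty for `n ≤ 2`). -/
def vSet (n : ℕ) : Set (LeafPerm n) := {g | ∃ i, i + 3 ≤ n ∧ g = x n (i + 2) ^ 2}

/-- `M_n = ⟨x_n, m_n, v_{n-3}, …, v_0⟩`. -/
def M (n : ℕ) : Subgroup (LeafPerm n) := Subgroup.closure ({x n n, m n} ∪ vSet n)

/-- `H_n = ⟨m_n, v_{n-3}, …, v_0⟩`. -/
def H (n : ℕ) : Subgroup (LeafPerm n) := Subgroup.closure ({m n} ∪ vSet n)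

/-- `N_n`, the normal closure of `H_n` in `M_n`. -/
def N (n : ℕ) : Subgroup (LeafPerm n) :=
  Subgroup.closure {y | ∃ g ∈ M n, ∃ h ∈ H n, y = g * h * g⁻¹}

/-- `M_n(2) = ⟨x_n², x_n m_n, N_n^od⟩`. -/
def M2 (n : ℕ) : Subgroup (LeafPerm n) :=
  Subgroup.closure ({x n n ^ 2, x n n * m n} ∪ od (N n))

/-! ## The polynomials and the level one data -/

/-- `h_a = (x + a)² - a - 1`. -/
noncomputable def h (a : ℤ) : ℤ[X] := (X + C a) ^ 2 - C a - 1

/-- The level `1` data of Model 6. -/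
def model6 : Data :=
  [([([s, n], 2)], 1 / 2),
   ([([n, n], 1), ([n, n], 1)], 1 / 8),
   ([([n, s], 1), ([n, s], 1)], 1 / 8),
   ([([s, n], 1), ([s, n], 1)], 1 / 8),
   ([([s, s], 1), ([s, s], 1)], 1 / 8)]

end MarkovModel

/-! Write an element of `Aut(T_{n+1})` as `node u v s`, i.e. `(u, v)σ^s`. Read `s` as 0 and `n` as 1
in `Fin 2`. The allowable children of a factor of type `(s, t)` suggest giving `node u v s` the type
`(s, t)` when the first entries of the types of `u` and `v` add up to `t` and the second entries add
up to `s`; this is `typeFiber`. The requirement on the second entries makes the process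
self-similar: types are additive under products, and if `s = 1` then `u * v` has type `(t, 1)`,
which is the type of the single child.

Group theory: `M2_eq_evenTypedGroup` identifies `M2 n`, for `n ≥ 1`, with the group of all elements
of type `(s, 0)`. The inputs are the recursive form of `m` (`m_succ`), obtained by following its
typed cycles, and the fact that elements of type `(1, 1)` are odometers, with a converse from level
2 on. The inclusion from right to left is an induction in which `node_mem_N` and
`evenTypedGroup_le_M2` alternate between `M2` and `N`.

Counting: encode cycle types as monomials in an additive monoid algebra, so that independent factors
multiply. The cycle type of `(u, v)` is the sum of those of `u` and `v`, and that of `(u, v)σ` is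
the doubled cycle type of `u * v`. Hence the average cycle type over a type fiber obeys a recursion
(`average_succ_zero`, `average_succ_one`), and the generating function of the Markov process from
one factor obeys the same one (`genFactor_succ_zero`, `genFactor_succ_one`). The level 1 data are
one such step applied to an equal mixture of `[ss,1]` and `[ns,1]`, the types that make up `M2`. -/

namespace MarkovModel

/-! ## Decomposition of the tree at its root -/

/-- The leaves of `T_{n+1}` as the leaves of the two copies of `T_n` below the root. -/
def halves (n : ℕ) : Fin 2 × Fin (2 ^ n) ≃ Fin (2 ^ (n + 1)) :=
  finProdFinEquiv.trans (finCongr (by rw [pow_succ, mul_comm]))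

theorem halves_val (n : ℕ) (b : Fin 2) (i : Fin (2 ^ n)) :
    (halves n (b, i) : ℕ) = i + 2 ^ n * b := rfl

/-- The permutation `(u, v) σ ^ s` of the leaves of `T_{n+1}`, where `σ` exchanges the two halves
and `u` and `v` act on the left and on the right half. -/
def node {n : ℕ} (u v : LeafPerm n) (s : Fin 2) : LeafPerm (n + 1) :=
  (halves n).permCongr
    { toFun := fun p => (p.1 + s, (if p.1 + s = 0 then u else v) p.2)
      invFun := fun p => (p.1 + s, (if p.1 = 0 then u else v).symm p.2)
      left_inv := by
        rintro ⟨b, i⟩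
        have h : b + s + s = b := by revert b s; decide
        simp [h]
      right_inv := by
        rintro ⟨b, i⟩
        have h : b + s + s = b := by revert b s; decide
        simp [h] }

section node

variable {n : ℕ} (u v u' v' : LeafPerm n) (s : Fin 2)

theorem node_apply (b : Fin 2) (i : Fin (2 ^ n)) :
    node u v s (halves n (b, i)) = halves n (b + s, (if b + s = 0 then u else v) i) := by
  simp [node, Equiv.permCongr_apply]

theorem halves_ext {g g' : LeafPerm (n + 1)}
    (hg : ∀ b i, g (halves n (b, i)) = g' (halves n (b, i))) : g = g' := by
  ext1 j
  obtain ⟨⟨b, i⟩, rfl⟩ := (halves n).surjective j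
  exact hg b i

theorem node_zero_apply_zero (i : Fin (2 ^ n)) :
    node u v 0 (halves n (0, i)) = halves n (0, u i) := by simp [node_apply]

theorem node_zero_apply_one (i : Fin (2 ^ n)) :
    node u v 0 (halves n (1, i)) = halves n (1, v i) := by simp [node_apply]

theorem node_one_apply_zero (i : Fin (2 ^ n)) :
    node u v 1 (halves n (0, i)) = halves n (1, v i) := by simp [node_apply]

theorem node_one_apply_one (i : Fin (2 ^ n)) :
    node u v 1 (halves n (1, i)) = halves n (0, u i) := by simp [node_apply]

theorem node_zero_mul : node u v 0 * node u' v' s = node (u * u') (v * v') s := by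
  refine halves_ext fun b i => ?_
  fin_cases s <;> fin_cases b <;> simp [node_apply]

theorem node_one_mul_zero : node u v 1 * node u' v' 0 = node (u * v') (v * u') 1 := by
  refine halves_ext fun b i => ?_
  fin_cases b <;> simp [node_apply]

theorem node_one_mul_one : node u v 1 * node u' v' 1 = node (u * v') (v * u') 0 := by
  refine halves_ext fun b i => ?_
  fin_cases b <;> simp [node_apply]

theorem node_one_one_zero : node (1 : LeafPerm n) 1 0 = 1 := by
  refine halves_ext fun b i => ?_
  fin_cases b <;> simp [node_apply]

theorem node_zero_inv : (node u v 0)⁻¹ = node u⁻¹ v⁻¹ 0 := by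
  rw [inv_eq_iff_mul_eq_one, node_zero_mul, mul_inv_cancel, mul_inv_cancel, node_one_one_zero]

theorem node_one_inv : (node u v 1)⁻¹ = node v⁻¹ u⁻¹ 1 := by
  rw [inv_eq_iff_mul_eq_one, node_one_mul_one, mul_inv_cancel, mul_inv_cancel, node_one_one_zero]

theorem node_injective {u v u' v' : LeafPerm n} {s s' : Fin 2} (hn : node u v s = node u' v' s') :
    u = u' ∧ v = v' ∧ s = s' := by
  have key : ∀ b i, (b + s, (if b + s = 0 then u else v) i) =
      (b + s', (if b + s' = 0 then u' else v') i) := fun b i => by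
    apply (halves n).injective
    rw [← node_apply, ← node_apply, hn]
  have hs : s = s' := by simpa using congrArg Prod.fst (key 0 0)
  subst hs
  refine ⟨Equiv.ext fun i => ?_, Equiv.ext fun i => ?_, rfl⟩
  · have := congrArg Prod.snd (key s i)
    have h2 : s + s = 0 := by clear * -; revert s; decide
    simpa [h2] using this
  · have := congrArg Prod.snd (key (1 + s) i)
    have h2 : 1 + s + s = 1 := by clear * -; revert s; decide
    simpa [h2] using this

theorem halves_div_eq_iff {j : ℕ} (b b' : Fin 2) (i i' : Fin (2 ^ n)) :
    (halves n (b, i) : ℕ) / 2 ^ j = (halves n (b', i') : ℕ) / 2 ^ j ↔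
      n < j ∨ (b = b' ∧ (i : ℕ) / 2 ^ j = (i' : ℕ) / 2 ^ j) := by
  rw [halves_val, halves_val]
  have hb := b.2
  have hb' := b'.2
  have hi := i.2
  have hi' := i'.2
  rcases lt_or_ge n j with hj | hj
  · have hle : 2 ^ n * 2 ≤ 2 ^ j := by
      rw [← pow_succ]; exact Nat.pow_le_pow_right (by norm_num) hj
    have e : ∀ (c : Fin 2) (k : Fin (2 ^ n)), ((k : ℕ) + 2 ^ n * c) / 2 ^ j = 0 := fun c k => by
      apply Nat.div_eq_of_lt
      have := c.2
      have := k.2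
      nlinarith
    simp [e, hj]
  · obtain ⟨d, rfl⟩ := Nat.exists_eq_add_of_le hj
    have e : ∀ (c : Fin 2) (k : Fin (2 ^ (j + d))),
        ((k : ℕ) + 2 ^ (j + d) * c) / 2 ^ j = (k : ℕ) / 2 ^ j + 2 ^ d * c := fun c k => by
      have : (k : ℕ) + 2 ^ (j + d) * c = k + 2 ^ j * (2 ^ d * c) := by ring
      rw [this, Nat.add_mul_div_left _ _ (by positivity)]
    have hlt : ∀ k : Fin (2 ^ (j + d)), (k : ℕ) / 2 ^ j < 2 ^ d := fun k => by
      rw [Nat.div_lt_iff_lt_mul (by positivity), ← pow_add, add_comm d j]; exact k.2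
    rw [e, e, Fin.ext_iff]
    have h1 := hlt i
    have h2 := hlt i'
    generalize (i : ℕ) / 2 ^ j = p at *
    generalize (i' : ℕ) / 2 ^ j = q at *
    generalize 2 ^ d = w at *
    have : ¬ (j + d < j) := by omega
    simp only [this, false_or]
    obtain h | h : (b : ℕ) = 0 ∨ (b : ℕ) = 1 := by omega
    all_goals
      obtain h' | h' : (b' : ℕ) = 0 ∨ (b' : ℕ) = 1 := by omega
      all_goals simp [h, h'] <;> omega

theorem node_mem_treeAut {u v : LeafPerm n} (hu : u ∈ treeAut n) (hv : v ∈ treeAut n) (s : Fin 2) :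
    node u v s ∈ treeAut (n + 1) := by
  intro j i i'
  obtain ⟨⟨b, k⟩, rfl⟩ := (halves n).surjective i
  obtain ⟨⟨b', k'⟩, rfl⟩ := (halves n).surjective i'
  rw [node_apply, node_apply, halves_div_eq_iff, halves_div_eq_iff, add_left_inj]
  refine or_congr Iff.rfl (and_congr_right fun h => ?_)
  subst h
  split_ifs
  · exact hu j k k'
  · exact hv j k k'

end node

/-! ## The elements `x_k` at the root -/

theorem a_succ_of_le {n k : ℕ} (hk : k ≤ n) : a (n + 1) k = node (a n k) 1 0 := by
  refine halves_ext fun b i => Fin.ext ?_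
  by_cases h1 : 1 ≤ k
  · have e : 2 * 2 ^ (k - 1) = 2 ^ k := by rw [← pow_succ', Nat.sub_add_cancel h1]
    have hle : 2 ^ k ≤ 2 ^ n := Nat.pow_le_pow_right (by norm_num) hk
    have hi := i.2
    have h2 : 1 ≤ k ∧ k ≤ n + 1 := ⟨h1, by omega⟩
    have h3 : 1 ≤ k ∧ k ≤ n := ⟨h1, hk⟩
    obtain rfl | rfl : b = 0 ∨ b = 1 := by fin_cases b <;> simp
    · rw [node_zero_apply_zero]
      simp [a, h2, h3, halves_val]
    · rw [node_zero_apply_one]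
      simp only [a, h2, halves_val, aFun, Equiv.coe_fn_mk, e, dite_true, and_self]
      simp only [Fin.val_one, Equiv.Perm.one_apply, mul_one]
      split_ifs <;> omega
  · rw [a, a, dif_neg (by omega), dif_neg (by omega), node_one_one_zero]

theorem a_succ_self (n : ℕ) : a (n + 1) (n + 1) = node 1 1 1 := by
  refine halves_ext fun b i => Fin.ext ?_
  have hi := i.2
  obtain rfl | rfl : b = 0 ∨ b = 1 := by fin_cases b <;> simp
  · rw [node_one_apply_zero]
    simp [a, halves_val, aFun]
  · rw [node_one_apply_one]
    simp [a, halves_val, aFun]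
    omega

theorem x_succ (n k : ℕ) : x n (k + 1) = x n k * a n (k + 1) := by
  simp [x, List.range_succ]

theorem x_zero (n : ℕ) : x n 0 = 1 := rfl

theorem x_succ_of_le {n k : ℕ} (hk : k ≤ n) : x (n + 1) k = node (x n k) 1 0 := by
  induction k with
  | zero => rw [x_zero, x_zero, node_one_one_zero]
  | succ k ih => rw [x_succ, x_succ, ih (by omega), a_succ_of_le hk, node_zero_mul, mul_one]

theorem x_succ_self (n : ℕ) : x (n + 1) (n + 1) = node (x n n) 1 1 := by
  rw [x_succ, x_succ_of_le le_rfl, a_succ_self, node_zero_mul, mul_one, mul_one]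

/-- The element of `W_n` that acts on the left half of the leaves of `T_{n+1}` as `m_{n+1}`. -/
def mLeft : (n : ℕ) → LeafPerm n
  | 0 => 1
  | n + 1 => node (x n n * mLeft n) 1 1

theorem x_mul_mLeft_succ (n : ℕ) :
    x (n + 1) (n + 1) * mLeft (n + 1) = node (x n n) (x n n * mLeft n) 0 := by
  rw [x_succ_self, mLeft, node_one_mul_one, mul_one, one_mul]

section m

open Letter

/-! ## The element `m_n` at the root -/

/-- `g'` permutes the children of the leaves as `g` permutes the leaves, exchanging the left and
right children of `g i` if `g i` is in `S`. -/
def IsLift {n : ℕ} (g : LeafPerm n) (S : Set ℕ) (g' : LeafPerm (n + 1)) : Prop :=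
  ∀ i, ((g i : ℕ) ∈ S → g' (leftChild i) = rightChild (g i) ∧ g' (rightChild i) = leftChild (g i)) ∧
    ((g i : ℕ) ∉ S → g' (leftChild i) = leftChild (g i) ∧ g' (rightChild i) = rightChild (g i))

theorem leftChild_halves {n : ℕ} (b : Fin 2) (i : Fin (2 ^ n)) :
    leftChild (halves n (b, i)) = halves (n + 1) (b, leftChild i) := by
  ext
  simp only [leftChild, halves_val, pow_succ]
  ring

theorem rightChild_halves {n : ℕ} (b : Fin 2) (i : Fin (2 ^ n)) :
    rightChild (halves n (b, i)) = halves (n + 1) (b, rightChild i) := by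
  ext
  simp only [rightChild, halves_val, pow_succ]
  ring

theorem IsLift.node {n : ℕ} {u v : LeafPerm n} {S T R : Set ℕ} {u' v' : LeafPerm (n + 1)}
    (hu : IsLift u S u') (hv : IsLift v T v') (s : Fin 2)
    (hS : ∀ i < 2 ^ n, i ∈ R ↔ i ∈ S) (hT : ∀ i < 2 ^ n, i + 2 ^ n ∈ R ↔ i ∈ T) :
    IsLift (MarkovModel.node u v s) R (MarkovModel.node u' v' s) := by
  intro i
  obtain ⟨⟨b, i⟩, rfl⟩ := (halves n).surjective i
  simp only [leftChild_halves, rightChild_halves, node_apply, halves_val]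
  obtain h | h : b + s = 0 ∨ b + s = 1 := by revert b s; decide
  · have := hS (u i) (u i).2
    have := hu i
    simp_all
  · have := hT (v i) (v i).2
    have := hv i
    simp_all

theorem IsLift.one (n : ℕ) : IsLift (1 : LeafPerm n) ∅ 1 := by
  intro i
  simp

/-- The odometer carries into the next level at exactly one place: over the leaf that is sent to 0.
-/
theorem isLift_x (n : ℕ) : IsLift (x n n) {0} (x (n + 1) (n + 1)) := by
  induction n with
  | zero => unfold IsLift; decide
  | succ n ih =>
    rw [x_succ_self, x_succ_self (n + 1)]
    refine ih.node (IsLift.one n) 1 (fun i _ => Iff.rfl) fun i _ => ?_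
    simp

/-- The first entries of the cycles of type `nn` that arise from a fixed leaf of type `sn` in `k`
steps of the restricted Markov process. -/
def starts (k : ℕ) : Set ℕ := {i | ∃ r, 1 ≤ r ∧ r ≤ k ∧ i + 2 ^ r = 2 ^ k}

theorem mem_starts_succ_of_lt {k i : ℕ} (hi : i < 2 ^ k) : i ∈ starts (k + 1) ↔ i = 0 := by
  constructor
  · rintro ⟨r, h1, h2, h3⟩
    obtain h | h : r = k + 1 ∨ r ≤ k := by omega
    · subst h; omega
    · have := Nat.pow_le_pow_right (n := 2) (by norm_num) h
      rw [pow_succ] at h3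
      omega
  · rintro rfl
    exact ⟨k + 1, by omega, le_rfl, by simp⟩

theorem add_mem_starts_succ {k i : ℕ} (_ : i < 2 ^ k) : i + 2 ^ k ∈ starts (k + 1) ↔ i ∈ starts k := by
  constructor
  · rintro ⟨r, h1, h2, h3⟩
    rw [pow_succ] at h3
    obtain h | h : r = k + 1 ∨ r ≤ k := by omega
    · subst h; rw [pow_succ] at h3; have := Nat.two_pow_pos k; omega
    · exact ⟨r, h1, h, by omega⟩
  · rintro ⟨r, h1, h2, h3⟩
    exact ⟨r, h1, by omega, by rw [pow_succ]; omega⟩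

/-- By `x_mul_mLeft_succ` the left section is the odometer, with its single exchange at 0, and the
right section is the same element one level lower. So the exchange set has 0 on the left and a copy
of itself on the right, which is the recursion of `starts`. -/
theorem isLift_x_mul_mLeft (n : ℕ) :
    IsLift (x n n * mLeft n) (starts n) (x (n + 1) (n + 1) * mLeft (n + 1)) := by
  induction n with
  | zero =>
    have : starts 0 = ∅ := by ext i; simp only [starts, Set.mem_ofPred_eq]; grind
    rw [this]
    unfold IsLift
    decide
  | succ n ih =>
    rw [x_mul_mLeft_succ, x_mul_mLeft_succ]
    exact (isLift_x n).node ih 0 (fun i hi => mem_starts_succ_of_lt hi)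
      fun i hi => add_mem_starts_succ hi

theorem lt_of_mem_starts {k i : ℕ} (hi : i ∈ starts k) : i + 2 ≤ 2 ^ k := by
  obtain ⟨r, h1, h2, h3⟩ := hi
  have := Nat.pow_le_pow_right (n := 2) (by norm_num) h1
  omega

/-- Only the first quarter of the leaves carries exchanges; there the relevant section is `x n n *
mLeft n`. -/
theorem isLift_node_mLeft (n : ℕ) :
    IsLift (node (mLeft (n + 1)) 1 0) (starts n) (node (mLeft (n + 2)) 1 0) := by
  have h1 : IsLift (mLeft (n + 1)) (starts n) (mLeft (n + 2)) := by
    refine (isLift_x_mul_mLeft n).node (IsLift.one n) 1 (fun i _ => Iff.rfl) fun i _ => ?_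
    simp only [Set.mem_empty_iff_false, iff_false]
    intro h
    have := lt_of_mem_starts h
    omega
  refine h1.node (IsLift.one _) 0 (fun i _ => Iff.rfl) fun i _ => ?_
  simp only [Set.mem_empty_iff_false, iff_false]
  intro h
  have := lt_of_mem_starts h
  rw [pow_succ] at this
  omega

/-! ### Following the typed cycles of `m` from level to level. -/

/-- The properties of the typed cycles of `m_{k+2}`: the permutation `g` acts on the cycle as a
rotation, and the place of the set `starts k` depends on the type. -/
def GoodCycle {k : ℕ} (g : LeafPerm (k + 2)) (c : TypedCycle (k + 2)) : Prop :=
  ∃ (p : Fin (2 ^ (k + 2))) (l : List (Fin (2 ^ (k + 2)))), c.1 = p :: l ∧ (p :: l).map g = l ++ [p] ∧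
    (∀ i ∈ l, (i : ℕ) ∉ starts k ∧ (i : ℕ) + 1 ≠ 2 ^ k) ∧
    ((c.2 = [n, n] ∧ (p : ℕ) ∈ starts k) ∨ (c.2 = [s, n] ∧ (p : ℕ) + 1 = 2 ^ k) ∨
      (c.2 = [s, s] ∧ (p : ℕ) ∉ starts k ∧ (p : ℕ) + 1 ≠ 2 ^ k))

/-- The new element `2 ^ (k + 1) - 2` is the left child of `2 ^ k - 1`, the start of the only cycle
of type `sn`: this cycle sheds a new cycle of type `nn`. -/
theorem leftChild_mem_starts {n k : ℕ} (i : Fin (2 ^ n)) :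
    (leftChild i : ℕ) ∈ starts (k + 1) ↔ (i : ℕ) ∈ starts k ∨ (i : ℕ) + 1 = 2 ^ k := by
  simp only [leftChild, starts, Set.mem_ofPred_eq]
  constructor
  · rintro ⟨r, h1, h2, h3⟩
    obtain ⟨r, rfl⟩ := Nat.exists_eq_add_of_le' h1
    rw [pow_succ, pow_succ] at h3
    rcases Nat.eq_zero_or_pos r with rfl | hr
    · right; omega
    · exact Or.inl ⟨r, hr, by omega, by omega⟩
  · rintro (⟨r, h1, h2, h3⟩ | h3)
    · exact ⟨r + 1, by omega, by omega, by rw [pow_succ, pow_succ]; omega⟩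
    · exact ⟨1, by omega, by omega, by rw [pow_succ 2 k]; omega⟩

theorem rightChild_notMem_starts {n k : ℕ} (i : Fin (2 ^ n)) :
    (rightChild i : ℕ) ∉ starts (k + 1) := by
  rintro ⟨r, h1, h2, h3⟩
  obtain ⟨r, rfl⟩ := Nat.exists_eq_add_of_le' h1
  simp only [rightChild, pow_succ] at h3
  omega

theorem leftChild_add_one_ne {n k : ℕ} (i : Fin (2 ^ n)) : (leftChild i : ℕ) + 1 ≠ 2 ^ (k + 1) := by
  simp only [leftChild, pow_succ]
  omega

theorem rightChild_add_one_eq_iff {n k : ℕ} (i : Fin (2 ^ n)) :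
    (rightChild i : ℕ) + 1 = 2 ^ (k + 1) ↔ (i : ℕ) + 1 = 2 ^ k := by
  simp only [rightChild, pow_succ]
  omega

theorem IsLift.map_children {n : ℕ} {g : LeafPerm n} {S : Set ℕ} {g' : LeafPerm (n + 1)}
    (hg : IsLift g S g') {l : List (Fin (2 ^ n))} (hl : ∀ i ∈ l.map g, (i : ℕ) ∉ S) :
    (l.map leftChild).map g' = (l.map g).map leftChild ∧
      (l.map rightChild).map g' = (l.map g).map rightChild := by
  simp only [List.map_map, List.map_inj_left, Function.comp_apply]
  exact ⟨fun i hi => ((hg i).2 (hl _ (List.mem_map_of_mem hi))).1,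
    fun i hi => ((hg i).2 (hl _ (List.mem_map_of_mem hi))).2⟩

/-- A cycle of type `nn` meets `starts k` once, at its first entry, so a lift exchanges the children
once per turn and the cycle doubles. The other cycles avoid `starts k`, so their lifts split. Type
`sn` is marked by the start `2 ^ k - 1`, whose right child is the next such mark; type `ns` never
occurs. -/
theorem GoodCycle.markovMap {k : ℕ} {g : LeafPerm (k + 2)} {g' : LeafPerm (k + 3)}
    (hg : IsLift g (starts k) g') {c : TypedCycle (k + 2)} (hc : GoodCycle g c) :
    (∀ d ∈ markovMapCycle c, GoodCycle (k := k + 1) g' d) ∧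
      (markovMapCycle c).flatMap Prod.fst = c.1.map leftChild ++ c.1.map rightChild := by
  obtain ⟨c, T⟩ := c
  obtain ⟨p, l, rfl, hrot, hl, hT⟩ := hc
  simp only at hT
  rcases hT with ⟨rfl, hp⟩ | ⟨rfl, hp⟩ | ⟨rfl, hp, hp'⟩
  · refine ⟨?_, by simp [markovMapCycle, restricted]⟩
    simp only [markovMapCycle, restricted, List.mem_singleton, forall_eq]
    refine ⟨leftChild p, l.map leftChild ++ (p :: l).map rightChild, by simp, ?_, ?_, ?_⟩
    · obtain ⟨l', q, hq⟩ := List.eq_nil_or_concat' (p :: l) |>.resolve_left (by simp)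
      have hql : l'.map g = l ∧ g q = p := by
        rw [hq, List.map_append, List.map_singleton] at hrot
        exact ⟨(List.append_inj' hrot rfl).1, by simpa using (List.append_inj' hrot rfl).2⟩
      obtain ⟨e1, e2⟩ := hg.map_children (l := l') (by rw [hql.1]; exact fun i hi => (hl i hi).1)
      have e3 := (hg q).1 (by rw [hql.2]; exact hp)
      have e5 : ((p :: l).map leftChild).map g' = l.map leftChild ++ [rightChild p] := by
        rw [hq, List.map_append, List.map_append, e1, hql.1]
        simp [e3, hql.2]
      have e6 : ((p :: l).map rightChild).map g' = l.map rightChild ++ [leftChild p] := by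
        rw [hq, List.map_append, List.map_append, e2, hql.1]
        simp [e3, hql.2]
      have e4 : leftChild p :: (l.map leftChild ++ (p :: l).map rightChild) =
          (p :: l).map leftChild ++ (p :: l).map rightChild := by simp
      rw [e4, List.map_append, e5, e6]
      simp
    · intro i hi
      simp only [List.mem_append, List.mem_map] at hi
      rcases hi with ⟨j, hj, rfl⟩ | ⟨j, hj, rfl⟩
      · rw [leftChild_mem_starts]
        exact ⟨by have := hl j hj; tauto, leftChild_add_one_ne j⟩
      · refine ⟨rightChild_notMem_starts j, ?_⟩
        rw [Ne, rightChild_add_one_eq_iff]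
        rcases List.mem_cons.1 hj with rfl | hj
        · have := lt_of_mem_starts hp
          omega
        · exact (hl j hj).2
    · exact Or.inl ⟨rfl, (leftChild_mem_starts p).2 (Or.inl hp)⟩
  all_goals
    refine ⟨?_, by simp [markovMapCycle, restricted]⟩
    have hp0 : (p : ℕ) ∉ starts k := by
      first
      | exact hp
      | intro h; have := lt_of_mem_starts h; omega
    obtain ⟨e1, e2⟩ := hg.map_children (l := p :: l) (by
      rw [hrot]
      intro i hi
      rcases List.mem_append.1 hi with hi | hi
      · exact (hl i hi).1
      · rw [List.mem_singleton.1 hi]; exact hp0)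
    simp only [markovMapCycle, restricted, List.mem_cons, forall_eq_or_imp, List.not_mem_nil,
      IsEmpty.forall_iff, implies_true, and_true]
    refine ⟨⟨leftChild p, l.map leftChild, by simp, ?_, ?_, ?_⟩,
      ⟨rightChild p, l.map rightChild, by simp, ?_, ?_, ?_⟩⟩
    · rw [hrot] at e1; simpa using e1
    · simp only [List.mem_map]
      rintro _ ⟨j, hj, rfl⟩
      rw [leftChild_mem_starts]
      exact ⟨by have := hl j hj; tauto, leftChild_add_one_ne j⟩
    · rw [leftChild_mem_starts]
      have := leftChild_add_one_ne (k := k) p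
      simp [*]
    · rw [hrot] at e2; simpa using e2
    · simp only [List.mem_map]
      rintro _ ⟨j, hj, rfl⟩
      rw [Ne, rightChild_add_one_eq_iff]
      exact ⟨rightChild_notMem_starts j, (hl j hj).2⟩
    · simp only [Ne, rightChild_add_one_eq_iff]
      have := rightChild_notMem_starts (k := k) p
      simp [*]

theorem flatMap_append_perm {α β : Type*} (f g : α → List β) (l : List α) :
    (l.flatMap fun i => f i ++ g i).Perm (l.flatMap f ++ l.flatMap g) := by
  induction l with
  | nil => simp
  | cons i l ih =>
    simp only [List.flatMap_cons, List.append_assoc]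
    refine List.Perm.append_left _ ((List.Perm.append_left _ ih).trans ?_)
    rw [← List.append_assoc, ← List.append_assoc]
    exact List.Perm.append_right _ List.perm_append_comm

theorem leftChild_injective {n : ℕ} : Function.Injective (leftChild (n := n)) := fun i j h => by
  simp only [leftChild, Fin.mk.injEq] at h
  omega

theorem rightChild_injective {n : ℕ} : Function.Injective (rightChild (n := n)) := fun i j h => by
  simp only [rightChild, Fin.mk.injEq] at h
  omega

theorem mCycles_good (k : ℕ) :
    (∀ c ∈ mCycles k, GoodCycle (node (mLeft (k + 1)) 1 0) c) ∧
      ((mCycles k).flatMap Prod.fst).Nodup ∧ ∀ i, i ∈ (mCycles k).flatMap Prod.fst := by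
  induction k with
  | zero =>
    have h0 : starts 0 = ∅ := by ext i; simp only [starts, Set.mem_ofPred_eq]; grind
    refine ⟨?_, by decide, by decide⟩
    simp only [mCycles, List.mem_cons, forall_eq_or_imp, List.not_mem_nil,
      IsEmpty.forall_iff, implies_true, and_true]
    refine ⟨⟨0, [1], rfl, by decide, by rw [h0]; decide, Or.inr (Or.inl ⟨rfl, rfl⟩)⟩,
      ⟨2, [], rfl, by decide, by simp, Or.inr (Or.inr ⟨rfl, by rw [h0]; decide, by decide⟩)⟩,
      ⟨3, [], rfl, by decide, by simp, Or.inr (Or.inr ⟨rfl, by rw [h0]; decide, by decide⟩)⟩⟩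
  | succ k ih =>
    obtain ⟨h1, h2, h3⟩ := ih
    have hstep := fun c hc => (h1 c hc).markovMap (isLift_node_mLeft k)
    have hflat : (mCycles (k + 1)).flatMap Prod.fst =
        (mCycles k).flatMap fun c => c.1.map leftChild ++ c.1.map rightChild := by
      rw [mCycles, List.flatMap_assoc]
      exact List.flatMap_congr fun c hc => (hstep c hc).2
    have hperm : ((mCycles (k + 1)).flatMap Prod.fst).Perm
        (((mCycles k).flatMap Prod.fst).map leftChild ++
          ((mCycles k).flatMap Prod.fst).map rightChild) := by
      rw [hflat, List.map_flatMap, List.map_flatMap]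
      exact flatMap_append_perm _ _ _
    refine ⟨?_, ?_, fun i => ?_⟩
    · intro d hd
      rw [mCycles, List.mem_flatMap] at hd
      obtain ⟨c, hc, hd⟩ := hd
      exact (hstep c hc).1 d hd
    · rw [hperm.nodup_iff, List.nodup_append]
      refine ⟨h2.map leftChild_injective, h2.map rightChild_injective, ?_⟩
      simp only [List.mem_map]
      rintro _ ⟨i, -, rfl⟩ _ ⟨j, -, rfl⟩ h
      simp only [leftChild, rightChild, Fin.mk.injEq] at h
      omega
    · rw [hperm.mem_iff, List.mem_append, List.mem_map, List.mem_map]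
      have hi := i.2
      have hpow : 2 ^ (k + 1 + 2) = 2 ^ (k + 2) * 2 := by ring
      rcases Nat.even_or_odd' (i : ℕ) with ⟨j, hj | hj⟩
      · exact Or.inl ⟨⟨j, by omega⟩, h3 _, Fin.ext hj.symm⟩
      · exact Or.inr ⟨⟨j, by omega⟩, h3 _, Fin.ext hj.symm⟩

/-! ### Products of disjoint cycles, and the recursive form of `m`. -/

theorem prod_formPerm_apply {α : Type*} [DecidableEq α] {L : List (List α)} (hL : L.flatten.Nodup)
    {c : List α} (hc : c ∈ L) {i : α} (hi : i ∈ c) :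
    (L.map List.formPerm).prod i = c.formPerm i := by
  have hfix : ∀ (L : List (List α)) (i : α), i ∉ L.flatten → (L.map List.formPerm).prod i = i := by
    intro L
    induction L with
    | nil => simp
    | cons d L ih =>
      intro i hi
      simp only [List.flatten_cons, List.mem_append, not_or] at hi
      rw [List.map_cons, List.prod_cons, Equiv.Perm.mul_apply, ih i hi.2,
        List.formPerm_apply_of_notMem hi.1]
  induction L with
  | nil => simp at hc
  | cons d L ih =>
    rw [List.flatten_cons, List.nodup_append] at hL
    obtain ⟨-, hL, hd⟩ := hL
    rw [List.map_cons, List.prod_cons, Equiv.Perm.mul_apply]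
    rcases List.mem_cons.1 hc with rfl | hc
    · rw [hfix L i fun h => hd i hi i h rfl]
    · rw [ih hL hc]
      apply List.formPerm_apply_of_notMem
      intro h
      exact hd _ h _ (List.mem_flatten.2 ⟨c, hc, List.formPerm_apply_mem_of_mem hi⟩) rfl

theorem formPerm_apply_of_map_eq_rotate {α : Type*} [DecidableEq α] {g : Equiv.Perm α} {p : α}
    {l : List α} (hl : (p :: l).Nodup) (h : (p :: l).map g = l ++ [p]) {i : α} (hi : i ∈ p :: l) :
    (p :: l).formPerm i = g i := by
  obtain ⟨k, hk, rfl⟩ := List.getElem_of_mem hi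
  rw [List.formPerm_apply_getElem _ hl]
  have h1 : ((p :: l).map g)[k]'(by simpa using hk) = (l ++ [p])[k]'(by simpa using hk) := by
    simp only [h]
  rw [List.getElem_map] at h1
  rw [h1]
  simp only [List.length_cons] at hk ⊢
  rcases Nat.lt_or_ge k l.length with hk' | hk'
  · have : (k + 1) % (l.length + 1) = k + 1 := Nat.mod_eq_of_lt (by omega)
    simp [this, hk', List.getElem_append_left]
  · have : k = l.length := by omega
    subst this
    simp

theorem m_succ (n : ℕ) : m (n + 1) = node (mLeft n) 1 0 := by
  cases n with
  | zero => exact node_one_one_zero.symm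
  | succ k =>
    obtain ⟨h1, h2, h3⟩ := mCycles_good k
    refine Equiv.ext fun i => ?_
    obtain ⟨c, hc, hi⟩ := List.mem_flatMap.1 (h3 i)
    have e : (mCycles k).map (fun c => c.1.formPerm) =
        ((mCycles k).map Prod.fst).map List.formPerm := by
      rw [List.map_map]; rfl
    rw [List.flatMap_def] at h2
    rw [m, e, prod_formPerm_apply h2 (List.mem_map_of_mem hc) hi]
    obtain ⟨p, l, hpl, hrot, -⟩ := h1 c hc
    have hnd : c.1.Nodup := (List.nodup_flatten.1 h2).1 _ (List.mem_map_of_mem hc)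
    rw [hpl] at hi hnd ⊢
    exact formPerm_apply_of_map_eq_rotate hnd hrot hi

end m

/-! ## The elements of `Aut(T_n)` of a given type -/

/-- `(u, v) ↦ node u v 0` as a homomorphism. -/
def nodeHom (n : ℕ) : LeafPerm n × LeafPerm n →* LeafPerm (n + 1) where
  toFun p := node p.1 p.2 0
  map_one' := node_one_one_zero
  map_mul' p q := (node_zero_mul p.1 p.2 q.1 q.2 0).symm

theorem node_zero_zpow {n : ℕ} (u v : LeafPerm n) (z : ℤ) :
    node u v 0 ^ z = node (u ^ z) (v ^ z) 0 :=
  (map_zpow (nodeHom n) (u, v) z).symm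

/-- The elements of `W_k` of type `(s, t)`: here `s` tells whether the two halves are exchanged,
`t` is the sum of the first entries of the types of the two sections, and the sum of the second
entries is required to be `s`. -/
def typeFiber : (k : ℕ) → Fin 2 → Fin 2 → Set (LeafPerm k)
  | 0, _, _ => {1}
  | k + 1, s, t => {g | ∃ u v p q p' q', p + p' = t ∧ q + q' = s ∧ u ∈ typeFiber k p q ∧
      v ∈ typeFiber k p' q' ∧ g = node u v s}

section typeFiber

variable {n : ℕ} {s t s' t' : Fin 2}

theorem node_mem_typeFiber {u v : LeafPerm n} {p q p' q' : Fin 2} (hu : u ∈ typeFiber n p q)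
    (hv : v ∈ typeFiber n p' q') (ht : p + p' = t) (hs : q + q' = s) :
    node u v s ∈ typeFiber (n + 1) s t :=
  ⟨u, v, p, q, p', q', ht, hs, hu, hv, rfl⟩

theorem one_mem_typeFiber (n : ℕ) : 1 ∈ typeFiber n 0 0 := by
  induction n with
  | zero => rfl
  | succ n ih =>
    rw [← node_one_one_zero]
    exact node_mem_typeFiber ih ih rfl rfl

theorem mul_mem_typeFiber {g h : LeafPerm n} (hg : g ∈ typeFiber n s t)
    (hh : h ∈ typeFiber n s' t') : g * h ∈ typeFiber n (s + s') (t + t') := by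
  induction n generalizing s t s' t' with
  | zero =>
    obtain rfl : g = 1 := hg
    obtain rfl : h = 1 := hh
    rfl
  | succ n ih =>
    obtain ⟨u, v, p, q, p', q', ht, hs, hu, hv, rfl⟩ := hg
    obtain ⟨w, y, r, o, r', o', ht', hs', hw, hy, rfl⟩ := hh
    obtain rfl | rfl : s = 0 ∨ s = 1 := by clear * -; revert s; decide
    · rw [node_zero_mul, zero_add]
      exact node_mem_typeFiber (ih hu hw) (ih hv hy)
        (by rw [← ht, ← ht', add_add_add_comm]) (by rw [add_add_add_comm, hs, hs', zero_add])
    · have e : node u v 1 * node w y s' = node (u * y) (v * w) (1 + s') := by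
        obtain rfl | rfl : s' = 0 ∨ s' = 1 := by clear * -; revert s'; decide
        · exact node_one_mul_zero u v w y
        · exact node_one_mul_one u v w y
      rw [e]
      exact node_mem_typeFiber (ih hu hy) (ih hv hw)
        (by rw [add_add_add_comm, ht, add_comm r', ht'])
        (by rw [add_add_add_comm, hs, add_comm o', hs'])

theorem inv_mem_typeFiber {g : LeafPerm n} (hg : g ∈ typeFiber n s t) :
    g⁻¹ ∈ typeFiber n s t := by
  induction n generalizing s t with
  | zero =>
    obtain rfl : g = 1 := hg
    rfl
  | succ n ih =>
    obtain ⟨u, v, p, q, p', q', ht, hs, hu, hv, rfl⟩ := hg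
    obtain rfl | rfl : s = 0 ∨ s = 1 := by clear * -; revert s; decide
    · rw [node_zero_inv]
      exact node_mem_typeFiber (ih hu) (ih hv) ht hs
    · rw [node_one_inv]
      exact node_mem_typeFiber (ih hv) (ih hu) (by rw [add_comm, ht]) (by rw [add_comm, hs])

theorem typeFiber_subset_treeAut {g : LeafPerm n} (hg : g ∈ typeFiber n s t) : g ∈ treeAut n := by
  induction n generalizing s t with
  | zero =>
    obtain rfl : g = 1 := hg
    exact one_mem _
  | succ n ih =>
    obtain ⟨u, v, p, q, p', q', ht, hs, hu, hv, rfl⟩ := hg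
    exact node_mem_treeAut (ih hu) (ih hv) s

/-- A type is not determined by the element at low levels: at level 0 the identity has all four
types, and at level 1 the second entry is free. This lemma and the next give uniqueness as far as it
holds. -/
theorem typeFiber_fst_unique {g : LeafPerm (n + 1)} (hg : g ∈ typeFiber (n + 1) s t)
    (hg' : g ∈ typeFiber (n + 1) s' t') : s = s' := by
  obtain ⟨u, v, p, q, p', q', ht, hs, hu, hv, rfl⟩ := hg
  obtain ⟨w, y, r, o, r', o', ht', hs', hw, hy, e⟩ := hg'
  exact (node_injective e).2.2

theorem typeFiber_snd_unique {g : LeafPerm (n + 2)} (hg : g ∈ typeFiber (n + 2) s t)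
    (hg' : g ∈ typeFiber (n + 2) s' t') : t = t' := by
  obtain ⟨u, v, p, q, p', q', rfl, hs, hu, hv, rfl⟩ := hg
  obtain ⟨w, y, r, o, r', o', rfl, hs', hw, hy, e⟩ := hg'
  obtain ⟨rfl, rfl, -⟩ := node_injective e
  rw [typeFiber_fst_unique hu hw, typeFiber_fst_unique hv hy]

theorem x_mem_typeFiber (n : ℕ) : x n n ∈ typeFiber n 1 1 := by
  induction n with
  | zero => rfl
  | succ n ih =>
    rw [x_succ_self]
    exact node_mem_typeFiber ih (one_mem_typeFiber n) rfl rfl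

theorem mLeft_mem_typeFiber (n : ℕ) : mLeft n ∈ typeFiber n 1 0 := by
  induction n with
  | zero => rfl
  | succ n ih =>
    exact node_mem_typeFiber (mul_mem_typeFiber (x_mem_typeFiber n) ih) (one_mem_typeFiber n)
      rfl rfl

theorem m_mem_typeFiber (n : ℕ) : m n ∈ typeFiber n 0 1 := by
  cases n with
  | zero => rfl
  | succ n =>
    rw [m_succ]
    exact node_mem_typeFiber (mLeft_mem_typeFiber n) (one_mem_typeFiber n) rfl rfl

theorem x_sq_succ_of_le {n i : ℕ} (hi : i ≤ n) : x (n + 1) i ^ 2 = node (x n i ^ 2) 1 0 := by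
  rw [x_succ_of_le hi, sq, sq, node_zero_mul, one_mul]

theorem x_sq_succ_self (n : ℕ) : x (n + 1) (n + 1) ^ 2 = node (x n n) (x n n) 0 := by
  rw [x_succ_self, sq, node_one_mul_one, mul_one, one_mul]

theorem x_sq_mem_typeFiber {n i : ℕ} (hi : i ≤ n) : x n i ^ 2 ∈ typeFiber n 0 0 := by
  induction n with
  | zero =>
    obtain rfl : i = 0 := by omega
    rfl
  | succ n ih =>
    obtain h | rfl : i ≤ n ∨ i = n + 1 := by omega
    · rw [x_sq_succ_of_le h]
      exact node_mem_typeFiber (ih h) (one_mem_typeFiber n) rfl rfl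
    · rw [sq]
      exact mul_mem_typeFiber (x_mem_typeFiber (n + 1)) (x_mem_typeFiber (n + 1))

end typeFiber

/-! ## Odometers -/

section odometer

variable {n : ℕ} {u v : LeafPerm n}

theorem node_one_zpow_two_mul (u v : LeafPerm n) (z : ℤ) :
    node u v 1 ^ (2 * z) = node ((u * v) ^ z) ((v * u) ^ z) 0 := by
  rw [zpow_mul, zpow_ofNat, sq, node_one_mul_one, node_zero_zpow]

theorem sameCycle_node_one (huv : ∀ i j, (u * v).SameCycle i j) (i j : Fin (2 ^ (n + 1))) :
    (node u v 1).SameCycle i j := by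
  have h0 : ∀ k l, (node u v 1).SameCycle (halves n (0, k)) (halves n (0, l)) := fun k l => by
    obtain ⟨z, hz⟩ := huv k l
    exact ⟨2 * z, by rw [node_one_zpow_two_mul, node_zero_apply_zero, hz]⟩
  have h1 : ∀ i, ∃ k, (node u v 1).SameCycle i (halves n (0, k)) := fun i => by
    obtain ⟨⟨b, k⟩, rfl⟩ := (halves n).surjective i
    obtain rfl | rfl : b = 0 ∨ b = 1 := by clear * -; revert b; decide
    · exact ⟨k, Equiv.Perm.SameCycle.refl _ _⟩
    · exact ⟨u k, 1, by rw [zpow_one, node_one_apply_one]⟩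
  obtain ⟨k, hk⟩ := h1 i
  obtain ⟨l, hl⟩ := h1 j
  exact hk.trans ((h0 k l).trans hl.symm)

theorem sameCycle_of_node_one (h : ∀ i j, (node u v 1).SameCycle i j) (i j : Fin (2 ^ n)) :
    (u * v).SameCycle i j := by
  obtain ⟨z, hz⟩ := h (halves n (0, i)) (halves n (0, j))
  obtain ⟨y, rfl | rfl⟩ := Int.even_or_odd' z
  · rw [node_one_zpow_two_mul, node_zero_apply_zero] at hz
    exact ⟨y, by simpa using hz⟩
  · rw [add_comm (2 * y) 1, zpow_one_add, node_one_zpow_two_mul, Equiv.Perm.mul_apply, node_zero_apply_zero,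
      node_one_apply_zero] at hz
    simp at hz

theorem not_sameCycle_node_zero (h : ∀ i j, (node u v 0).SameCycle i j) : False := by
  have i : Fin (2 ^ n) := ⟨0, by positivity⟩
  obtain ⟨z, hz⟩ := h (halves n (0, i)) (halves n (1, i))
  rw [node_zero_zpow, node_zero_apply_zero] at hz
  simp at hz

end odometer

/-- For `node u v 1` of type `(1, 1)` the product `u * v` again has type `(1, 1)`, and transitivity
of `u * v` on one half gives transitivity on the whole. -/
theorem sameCycle_of_mem_typeFiber {n : ℕ} {w : LeafPerm n} (hw : w ∈ typeFiber n 1 1)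
    (i j : Fin (2 ^ n)) : w.SameCycle i j := by
  induction n with
  | zero =>
    obtain rfl : i = j := Subsingleton.elim (α := Fin 1) i j
    exact Equiv.Perm.SameCycle.refl _ _
  | succ n ih =>
    obtain ⟨u, v, p, q, p', q', ht, hs, hu, hv, rfl⟩ := hw
    refine sameCycle_node_one (fun k l => ih ?_ k l) i j
    have := mul_mem_typeFiber hu hv
    rwa [ht, hs] at this

/-- A transitive element exchanges the halves. Its square acts on the left half as `u * v`, which
must be transitive too, and the first entry of the type of `u * v` is `t`. -/
theorem type_eq_of_sameCycle {n : ℕ} {w : LeafPerm (n + 2)} {s t : Fin 2}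
    (hw : w ∈ typeFiber (n + 2) s t) (h : ∀ i j, w.SameCycle i j) : t = 1 := by
  have key : ∀ {k : ℕ} {g : LeafPerm (k + 1)} {s t : Fin 2}, g ∈ typeFiber (k + 1) s t →
      (∀ i j, g.SameCycle i j) → s = 1 := by
    intro k g s t hg h
    obtain ⟨u, v, p, q, p', q', ht, hs, hu, hv, rfl⟩ := hg
    obtain rfl | rfl : s = 0 ∨ s = 1 := by clear * -; revert s; decide
    · exact (not_sameCycle_node_zero h).elim
    · rfl
  obtain rfl := key hw h
  obtain ⟨u, v, p, q, p', q', rfl, hs, hu, hv, rfl⟩ := hw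
  exact key (mul_mem_typeFiber hu hv) (sameCycle_of_node_one h)

/-! ## The groups in terms of types -/

/-- The elements of some type. -/
def typedGroup (n : ℕ) : Subgroup (LeafPerm n) where
  carrier := {g | ∃ s t, g ∈ typeFiber n s t}
  one_mem' := ⟨0, 0, one_mem_typeFiber n⟩
  mul_mem' := fun ⟨_, _, hg⟩ ⟨_, _, hh⟩ => ⟨_, _, mul_mem_typeFiber hg hh⟩
  inv_mem' := fun ⟨_, _, hg⟩ => ⟨_, _, inv_mem_typeFiber hg⟩

/-- The elements of some type whose second entry is trivial. -/
def evenTypedGroup (n : ℕ) : Subgroup (LeafPerm n) where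
  carrier := {g | ∃ s, g ∈ typeFiber n s 0}
  one_mem' := ⟨0, one_mem_typeFiber n⟩
  mul_mem' := fun ⟨_, hg⟩ ⟨_, hh⟩ => ⟨_, mul_mem_typeFiber hg hh⟩
  inv_mem' := fun ⟨_, hg⟩ => ⟨_, inv_mem_typeFiber hg⟩

theorem mem_evenTypedGroup {n : ℕ} {g : LeafPerm n} :
    g ∈ evenTypedGroup n ↔ ∃ s, g ∈ typeFiber n s 0 := Iff.rfl

theorem fin_two_add_self (t : Fin 2) : t + t = 0 := by revert t; decide

theorem conj_mem_evenTypedGroup {n : ℕ} {g h : LeafPerm n} (hg : g ∈ typedGroup n)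
    (hh : h ∈ evenTypedGroup n) : g * h * g⁻¹ ∈ evenTypedGroup n := by
  obtain ⟨s, t, hg⟩ := hg
  obtain ⟨s', hh⟩ := hh
  refine ⟨s + s' + s, ?_⟩
  have := mul_mem_typeFiber (mul_mem_typeFiber hg hh) (inv_mem_typeFiber hg)
  rwa [add_zero, fin_two_add_self] at this

theorem vSet_subset (n : ℕ) : vSet n ⊆ {g | ∃ i, i + 1 ≤ n ∧ g = x n i ^ 2} := by
  rintro _ ⟨i, hi, rfl⟩
  exact ⟨i + 2, by omega, rfl⟩

theorem M_le_typedGroup (n : ℕ) : M n ≤ typedGroup n := by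
  rw [M, Subgroup.closure_le]
  rintro g ((rfl | rfl) | hg)
  · exact ⟨1, 1, x_mem_typeFiber n⟩
  · exact ⟨0, 1, m_mem_typeFiber n⟩
  · obtain ⟨i, hi, rfl⟩ := vSet_subset n hg
    exact ⟨0, 0, x_sq_mem_typeFiber (by omega)⟩

theorem H_le_M (n : ℕ) : H n ≤ M n := by
  refine Subgroup.closure_mono (Set.union_subset_union_left _ ?_)
  simp

theorem conj_mem_N {n : ℕ} {g y : LeafPerm n} (hg : g ∈ M n) (hy : y ∈ N n) :
    g * y * g⁻¹ ∈ N n := by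
  induction hy using Subgroup.closure_induction with
  | mem y hy =>
    obtain ⟨k, hk, h, hh, rfl⟩ := hy
    exact Subgroup.subset_closure ⟨g * k, mul_mem hg hk, h, hh, by group⟩
  | one => simp
  | mul y z _ _ ihy ihz =>
    have := mul_mem ihy ihz
    rwa [conj_mul] at this
  | inv y _ ih =>
    have := inv_mem ih
    rwa [conj_inv] at this

theorem H_le_N (n : ℕ) : H n ≤ N n := fun h hh =>
  Subgroup.subset_closure ⟨1, one_mem _, h, hh, by simp⟩

theorem N_le_M (n : ℕ) : N n ≤ M n := by
  rw [N, Subgroup.closure_le]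
  rintro _ ⟨g, hg, h, hh, rfl⟩
  exact mul_mem (mul_mem hg (H_le_M n hh)) (inv_mem hg)

/-- The generators of `H` have even sections, and pairs of even sections are stable under
conjugation by typed elements, hence by `M`. -/
theorem N_succ_le (n : ℕ) :
    N (n + 1) ≤ ((evenTypedGroup n).prod (evenTypedGroup n)).map (nodeHom n) := by
  have hH : H (n + 1) ≤ ((evenTypedGroup n).prod (evenTypedGroup n)).map (nodeHom n) := by
    rw [H, Subgroup.closure_le]
    rintro h (rfl | hh)
    · exact ⟨(mLeft n, 1), ⟨⟨1, mLeft_mem_typeFiber n⟩, one_mem _⟩, (m_succ n).symm⟩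
    · obtain ⟨i, hi, rfl⟩ := vSet_subset _ hh
      exact ⟨(x n i ^ 2, 1), ⟨⟨0, x_sq_mem_typeFiber (by omega)⟩, one_mem _⟩,
        (x_sq_succ_of_le (by omega)).symm⟩
  rw [N, Subgroup.closure_le]
  rintro _ ⟨g, hg, h, hh, rfl⟩
  obtain ⟨⟨u, v⟩, ⟨hu, hv⟩, rfl⟩ := hH hh
  obtain ⟨s, t, a, b, p, q, p', q', ht, hs, ha, hb, rfl⟩ := M_le_typedGroup _ hg
  have ha : a ∈ typedGroup n := ⟨_, _, ha⟩
  have hb : b ∈ typedGroup n := ⟨_, _, hb⟩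
  obtain rfl | rfl : s = 0 ∨ s = 1 := by clear * -; revert s; decide
  · refine ⟨(a * u * a⁻¹, b * v * b⁻¹),
      ⟨conj_mem_evenTypedGroup ha hu, conj_mem_evenTypedGroup hb hv⟩, ?_⟩
    simp only [nodeHom, MonoidHom.coe_mk, OneHom.coe_mk, node_zero_inv, node_zero_mul]
  · refine ⟨(a * v * a⁻¹, b * u * b⁻¹),
      ⟨conj_mem_evenTypedGroup ha hv, conj_mem_evenTypedGroup hb hu⟩, ?_⟩
    simp only [nodeHom, MonoidHom.coe_mk, OneHom.coe_mk, node_one_inv, node_one_mul_zero,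
      node_one_mul_one]

theorem x_mul_m_mem_typeFiber (n : ℕ) : x n n * m n ∈ typeFiber n 1 0 :=
  mul_mem_typeFiber (x_mem_typeFiber n) (m_mem_typeFiber n)

theorem M2_succ_le (n : ℕ) : M2 (n + 1) ≤ evenTypedGroup (n + 1) := by
  rw [M2, Subgroup.closure_le]
  rintro g ((rfl | rfl) | ⟨hg, -, hod⟩)
  · exact ⟨0, x_sq_mem_typeFiber le_rfl⟩
  · exact ⟨1, x_mul_m_mem_typeFiber _⟩
  · obtain ⟨⟨u, v⟩, ⟨⟨p, hu⟩, ⟨p', hv⟩⟩, rfl⟩ := N_succ_le n hg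
    change ∃ s, node u v 0 ∈ typeFiber (n + 1) s 0
    -- At level 0 a section has every type, so even types can be chosen freely; above that the
    -- odometer condition decides the second entry.
    cases n with
    | zero => exact ⟨0, u, v, 0, 0, 0, 0, rfl, rfl, hu, hv, rfl⟩
    | succ n =>
      have hmem : node u v 0 ∈ typeFiber (n + 2) 0 (p + p') := node_mem_typeFiber hu hv rfl rfl
      have := type_eq_of_sameCycle (mul_mem_typeFiber (x_mem_typeFiber _) hmem) hod
      rw [add_eq_left] at this
      rw [this] at hmem
      exact ⟨0, hmem⟩

theorem x_mem_M (n : ℕ) : x n n ∈ M n := Subgroup.subset_closure (Or.inl (Or.inl rfl))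

theorem m_mem_M (n : ℕ) : m n ∈ M n := Subgroup.subset_closure (Or.inl (Or.inr rfl))

theorem M2_le_M (n : ℕ) : M2 n ≤ M n := by
  rw [M2, Subgroup.closure_le]
  rintro g ((rfl | rfl) | ⟨hg, -⟩)
  · exact pow_mem (x_mem_M n) 2
  · exact mul_mem (x_mem_M n) (m_mem_M n)
  · exact N_le_M n hg

/-- Conjugation by `x` moves the even elements from the left half to the right, so `N` contains all
pairs of even sections. Those of type `(0, 0)` lie in `N^od`, because `x` times them has type `(1,
1)`. The generators `x ^ 2` and `x * m` reach the remaining elements. -/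
theorem evenTypedGroup_le_M2 {n : ℕ}
    (hN : ∀ u ∈ evenTypedGroup n, node u 1 0 ∈ N (n + 1)) :
    evenTypedGroup (n + 1) ≤ M2 (n + 1) := by
  have hN' : ∀ u ∈ evenTypedGroup n, ∀ v ∈ evenTypedGroup n, node u v 0 ∈ N (n + 1) := by
    intro u hu v hv
    have h1 := conj_mem_N (x_mem_M (n + 1)) (hN v hv)
    rw [x_succ_self, node_one_inv, node_one_mul_zero, node_one_mul_one, mul_one, one_mul,
      mul_inv_cancel, inv_one, mul_one] at h1
    have := mul_mem (hN u hu) h1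
    rwa [node_zero_mul, mul_one, one_mul] at this
  have hod : ∀ u ∈ evenTypedGroup n, ∀ v ∈ evenTypedGroup n,
      node u v 0 ∈ typeFiber (n + 1) 0 0 → node u v 0 ∈ M2 (n + 1) := by
    intro u hu v hv huv
    have hx : x (n + 1) (n + 1) * node u v 0 ∈ typeFiber (n + 1) 1 1 :=
      mul_mem_typeFiber (x_mem_typeFiber _) huv
    exact Subgroup.subset_closure (Or.inr ⟨hN' u hu v hv, typeFiber_subset_treeAut hx,
      sameCycle_of_mem_typeFiber hx⟩)
  have hx2 : x (n + 1) (n + 1) ^ 2 ∈ M2 (n + 1) := Subgroup.subset_closure (Or.inl (Or.inl rfl))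
  have hxm : x (n + 1) (n + 1) * m (n + 1) ∈ M2 (n + 1) :=
    Subgroup.subset_closure (Or.inl (Or.inr rfl))
  have hzero : ∀ g ∈ typeFiber (n + 1) 0 0, g ∈ M2 (n + 1) := by
    rintro _ ⟨u, v, p, q, p', q', ht, hs, hu, hv, rfl⟩
    obtain rfl : p' = p := by clear * - ht; revert p p'; decide
    obtain rfl : q' = q := by clear * - hs; revert q q'; decide
    obtain rfl | rfl : q' = 0 ∨ q' = 1 := by clear * -; revert q'; decide
    · exact hod u ⟨_, hu⟩ v ⟨_, hv⟩ (node_mem_typeFiber hu hv ht hs)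
    -- Both sections are odd here; dividing by `x ^ 2`, whose two sections are odometers of type
    -- `(1, 1)`, makes them even.
    · have hx := inv_mem_typeFiber (x_mem_typeFiber n)
      have hu' := mul_mem_typeFiber hx hu
      have hv' := mul_mem_typeFiber hx hv
      have := mul_mem hx2 (hod _ ⟨_, hu'⟩ _ ⟨_, hv'⟩
        (node_mem_typeFiber hu' hv' (fin_two_add_self _) rfl))
      rwa [x_sq_succ_self, node_zero_mul, mul_inv_cancel_left, mul_inv_cancel_left] at this
  rintro g ⟨s, hg⟩
  obtain rfl | rfl : s = 0 ∨ s = 1 := by clear * -; revert s; decide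
  · exact hzero g hg
  · have := mul_mem hxm (hzero _ (mul_mem_typeFiber (inv_mem_typeFiber
      (x_mul_m_mem_typeFiber (n + 1))) hg))
    rwa [mul_inv_cancel_left] at this

/-! ### The inductive step from `M2` to `N` one level higher. -/

theorem mLeft_mul_x (n : ℕ) :
    mLeft (n + 1) * x (n + 1) (n + 1) = x (n + 1) (n + 1) ^ 2 * m (n + 1) := by
  rw [x_sq_succ_self, m_succ, mLeft, x_succ_self, node_one_mul_one, node_zero_mul, mul_one, one_mul,
    mul_one]

/-- If `K` is normalized by `x` and contains `x ^ 2`, then the `g` with `g ∈ K` or `x g ∈ K` form a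
subgroup. -/
def twoCosets {G : Type*} [Group G] (K : Subgroup G) (x : G) (hx2 : x ^ 2 ∈ K)
    (hconj : ∀ k ∈ K, x * k * x⁻¹ ∈ K) (hconj' : ∀ k ∈ K, x⁻¹ * k * x ∈ K) : Subgroup G where
  carrier := {g | g ∈ K ∨ x * g ∈ K}
  one_mem' := Or.inl (one_mem K)
  mul_mem' := by
    rintro g h (hg | hg) (hh | hh)
    · exact Or.inl (mul_mem hg hh)
    · right
      have := mul_mem (hconj g hg) hh
      rwa [show x * g * x⁻¹ * (x * h) = x * (g * h) by group] at this
    · right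
      rw [← mul_assoc]
      exact mul_mem hg hh
    · left
      have := mul_mem (mul_mem (hconj' _ hg) (inv_mem hx2)) hh
      rwa [show x⁻¹ * (x * g) * x * (x ^ 2)⁻¹ * (x * h) = g * h by group] at this
  inv_mem' := by
    rintro g (hg | hg)
    · exact Or.inl (inv_mem hg)
    · right
      have := mul_mem (hconj _ (inv_mem hg)) hx2
      rwa [show x * (x * g)⁻¹ * x⁻¹ * x ^ 2 = x * g⁻¹ by group] at this

/-- Let `K` consist of the `k` with `(k, 1)` in `N`, and let `y` be the odometer. Since the square
of the next odometer is `(y, y)`, conjugation by `y` preserves `K`, and `M` is covered by `K` and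
`y⁻¹K`. An even `u` cannot lie in the second coset: `y * u` would be odd, while `N_succ_le` makes
the elements of `K` even. -/
theorem node_mem_N {n : ℕ} (hM2 : evenTypedGroup (n + 1) ≤ M2 (n + 1)) :
    ∀ u ∈ evenTypedGroup (n + 1), node u 1 0 ∈ N (n + 2) := by
  let K : Subgroup (LeafPerm (n + 1)) :=
    (N (n + 2)).comap ((nodeHom (n + 1)).comp (MonoidHom.inl _ _))
  have hK : ∀ k, k ∈ K ↔ node k 1 0 ∈ N (n + 2) := fun k => Iff.rfl
  set y := x (n + 1) (n + 1) with hy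
  have hx2M : node y y 0 ∈ M (n + 2) := by
    rw [hy, ← x_sq_succ_self]
    exact pow_mem (x_mem_M _) 2
  have hconj : ∀ k ∈ K, y * k * y⁻¹ ∈ K := by
    intro k hk
    have := conj_mem_N hx2M ((hK k).1 hk)
    rwa [node_zero_inv, node_zero_mul, node_zero_mul, mul_one, mul_inv_cancel] at this
  have hconj' : ∀ k ∈ K, y⁻¹ * k * y ∈ K := by
    intro k hk
    have := conj_mem_N (inv_mem hx2M) ((hK k).1 hk)
    rwa [inv_inv, node_zero_inv, node_zero_mul, node_zero_mul, mul_one, inv_mul_cancel] at this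
  have hv : ∀ i, 2 ≤ i → i ≤ n + 1 → x (n + 1) i ^ 2 ∈ K := by
    intro i h1 h2
    rw [hK, ← x_sq_succ_of_le h2]
    obtain ⟨j, rfl⟩ := Nat.exists_eq_add_of_le' h1
    exact H_le_N _ (Subgroup.subset_closure (Or.inr ⟨j, by omega, rfl⟩))
  have hy2 : y ^ 2 ∈ K := by
    -- The squares among the generators of `H` start with `x_2²`; the square of `x_1` is trivial.
    rcases Nat.eq_zero_or_pos n with rfl | hn
    · rw [hy, x_sq_succ_self, x_zero, node_one_one_zero]
      exact one_mem _
    · exact hv _ (by omega) le_rfl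
  have hm : mLeft (n + 1) ∈ K := by
    rw [hK, ← m_succ]
    exact H_le_N _ (Subgroup.subset_closure (Or.inl rfl))
  have hym : y * m (n + 1) ∈ K := by
    have := hconj' _ hm
    rwa [mul_assoc, mLeft_mul_x, sq, ← mul_assoc, ← mul_assoc, inv_mul_cancel, one_mul] at this
  have hM : M (n + 1) ≤ twoCosets K y hy2 hconj hconj' := by
    rw [M, Subgroup.closure_le]
    rintro g ((rfl | rfl) | ⟨i, hi, rfl⟩)
    · right
      rwa [sq] at hy2
    · exact Or.inr hym
    · exact Or.inl (hv _ (by omega) (by omega))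
  intro u hu
  rw [← hK]
  rcases hM (M2_le_M _ (hM2 hu)) with h | h
  · exact h
  -- At level 1 the second entry is not determined, so parity gives no contradiction; instead `y`
  -- itself is in `K`.
  · cases n with
    | zero =>
      have e : y = mLeft 1 := by
        rw [hy, x_succ_self, mLeft]
        simp [x_zero, mLeft]
      have := mul_mem (inv_mem hm) h
      rwa [← e, inv_mul_cancel_left] at this
    | succ n =>
      obtain ⟨s, hu⟩ := hu
      obtain ⟨⟨w, w'⟩, ⟨⟨s', hw⟩, -⟩, hww⟩ := N_succ_le _ ((hK _).1 h)
      obtain ⟨rfl, -⟩ := node_injective (show node w w' 0 = node (y * u) 1 0 from hww)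
      have := typeFiber_snd_unique hw (mul_mem_typeFiber (x_mem_typeFiber _) hu)
      simp at this

/-- The two preceding implications are chained: even elements lie in `M2` at one level, hence on the
left half in `N` at the next, hence in `M2` at the next. -/
theorem M2_eq_evenTypedGroup (n : ℕ) : M2 (n + 1) = evenTypedGroup (n + 1) := by
  refine le_antisymm (M2_succ_le n) ?_
  induction n with
  | zero =>
    refine evenTypedGroup_le_M2 ?_
    rintro u ⟨s, rfl⟩
    rw [node_one_one_zero]
    exact one_mem _
  | succ n ih => exact evenTypedGroup_le_M2 (node_mem_N ih)

/-! ## Cycle types through minimal periods -/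

section periods

variable {α : Type*}

/-- The multiset in which each `d ∈ S` is repeated `d` times. -/
def repeated (S : Multiset ℕ) : Multiset ℕ := S.bind fun d => Multiset.replicate d d

theorem minimalPeriod_dvd_iff (g : Equiv.Perm α) (i : α) (k : ℕ) :
    Function.minimalPeriod g i ∣ k ↔ (g ^ k) i = i := by
  rw [← Function.isPeriodicPt_iff_minimalPeriod_dvd, Function.IsPeriodicPt, Function.IsFixedPt,
    Equiv.Perm.iterate_eq_pow]

theorem minimalPeriod_eq_of_forall {g : Equiv.Perm α} {i : α} {d : ℕ}
    (h : ∀ k, (g ^ k) i = i ↔ d ∣ k) : Function.minimalPeriod g i = d :=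
  Nat.dvd_antisymm ((minimalPeriod_dvd_iff g i d).2 ((h d).2 dvd_rfl))
    ((h _).1 ((minimalPeriod_dvd_iff g i _).1 dvd_rfl))

theorem repeated_add (S T : Multiset ℕ) : repeated (S + T) = repeated S + repeated T :=
  Multiset.add_bind _ _ _

theorem count_repeated (S : Multiset ℕ) (d : ℕ) : (repeated S).count d = d * S.count d := by
  induction S using Multiset.induction_on with
  | empty => simp [repeated]
  | cons e S ih =>
    rw [repeated, Multiset.cons_bind, Multiset.count_add, ← repeated, ih, Multiset.count_replicate,
      Multiset.count_cons]
    by_cases h : d = e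
    · subst h; simp; ring
    · have : ¬ e = d := fun h' => h h'.symm
      simp [h, this]

theorem minimalPeriod_mul_of_fixed {g h : Equiv.Perm α} (hgh : Commute g h) {i : α} (hi : h i = i) :
    Function.minimalPeriod (g * h : Equiv.Perm α) i = Function.minimalPeriod g i := by
  refine minimalPeriod_eq_of_forall fun k => ?_
  have : (h ^ k) i = i := Equiv.Perm.pow_apply_eq_self_of_apply_eq_self hi k
  rw [hgh.mul_pow, Equiv.Perm.mul_apply, this, minimalPeriod_dvd_iff]

variable [Fintype α] [DecidableEq α]

/-- The multiset of the minimal periods of all points. -/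
noncomputable def periods (g : Equiv.Perm α) : Multiset ℕ := ∑ i, {Function.minimalPeriod g i}

theorem sum_support_minimalPeriod (g : Equiv.Perm α) :
    ∑ i ∈ g.support, ({Function.minimalPeriod g i} : Multiset ℕ) = repeated g.cycleType := by
  induction g using Equiv.Perm.cycle_induction_on with
  | base_one => simp [repeated]
  | base_cycles g hg =>
    have : ∀ i ∈ g.support, ({Function.minimalPeriod g i} : Multiset ℕ) = {g.support.card} := by
      intro i hi
      rw [minimalPeriod_eq_of_forall (d := g.support.card)]
      intro k
      rw [← hg.orderOf, orderOf_dvd_iff_pow_eq_one, hg.pow_eq_one_iff' (Equiv.Perm.mem_support.1 hi)]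
    rw [Finset.sum_congr rfl this, Finset.sum_const, hg.cycleType]
    simp [repeated, Multiset.nsmul_singleton]
  | induction_disjoint g h hd _ ihg ihh =>
    rw [hd.support_mul, Finset.sum_union hd.disjoint_support, hd.cycleType_mul, repeated_add, ← ihg,
      ← ihh]
    congr 1
    · refine Finset.sum_congr rfl fun i hi => ?_
      rw [minimalPeriod_mul_of_fixed hd.commute]
      exact (hd i).resolve_left (Equiv.Perm.mem_support.1 hi)
    · refine Finset.sum_congr rfl fun i hi => ?_
      rw [hd.commute.eq, minimalPeriod_mul_of_fixed hd.commute.symm]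
      exact (hd i).resolve_right (Equiv.Perm.mem_support.1 hi)

theorem periods_eq_repeated (g : Equiv.Perm α) : periods g = repeated g.partition.parts := by
  have hfix : ∀ i ∈ g.supportᶜ, ({Function.minimalPeriod g i} : Multiset ℕ) = {1} := by
    intro i hi
    rw [Finset.mem_compl, Equiv.Perm.notMem_support] at hi
    rw [Function.minimalPeriod_eq_one_iff_isFixedPt.2 hi]
  rw [periods, Equiv.Perm.parts_partition, repeated_add, ← sum_support_minimalPeriod,
    ← Finset.sum_add_sum_compl g.support, Finset.sum_congr rfl hfix, Finset.sum_const,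
    Finset.card_compl]
  congr 1
  ext d
  rw [count_repeated, Multiset.nsmul_singleton, Multiset.count_replicate]
  split_ifs with h
  · simp [← h]
  · simp

/-- A cycle of length `d` contributes `d` points of period `d`, so for positive lengths the periods
determine the cycle type. Periods are easier than cycles to compute through `node`. -/
theorem parts_eq_of_periods {g : Equiv.Perm α} {S : Multiset ℕ} (hS : ∀ d ∈ S, 0 < d)
    (h : periods g = repeated S) : g.partition.parts = S := by
  ext d
  rcases Nat.eq_zero_or_pos d with rfl | hd
  · rw [Multiset.count_eq_zero.2 fun h0 => (hS 0 h0).false,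
      Multiset.count_eq_zero.2 fun h0 => (g.partition.parts_pos h0).false]
  · rw [periods_eq_repeated] at h
    have := congrArg (Multiset.count d) h
    rw [count_repeated, count_repeated] at this
    exact Nat.eq_of_mul_eq_mul_left hd this

end periods

section cycleTypeFull

variable {n : ℕ} (u v : LeafPerm n)

theorem sum_halves {R : Type*} [AddCommMonoid R] (f : Fin (2 ^ (n + 1)) → R) :
    ∑ i, f i = ∑ i, f (halves n (0, i)) + ∑ i, f (halves n (1, i)) := by
  rw [← (halves n).sum_comp, Fintype.sum_prod_type, Fin.sum_univ_two]

theorem node_zero_pow (k : ℕ) : node u v 0 ^ k = node (u ^ k) (v ^ k) 0 :=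
  (map_pow (nodeHom n) (u, v) k).symm

theorem cycleTypeFull_pos {g : LeafPerm n} {d : ℕ} (hd : d ∈ cycleTypeFull g) : 0 < d :=
  g.partition.parts_pos hd

theorem periods_eq_repeated_cycleTypeFull : periods u = repeated (cycleTypeFull u) :=
  periods_eq_repeated u

theorem cycleTypeFull_node_zero :
    cycleTypeFull (node u v 0) = cycleTypeFull u + cycleTypeFull v := by
  refine parts_eq_of_periods (fun d hd => ?_) ?_
  · rcases Multiset.mem_add.1 hd with h | h <;> exact cycleTypeFull_pos h
  · rw [periods, sum_halves, repeated_add, ← periods_eq_repeated_cycleTypeFull,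
      ← periods_eq_repeated_cycleTypeFull, periods, periods]
    congr 1
    · refine Finset.sum_congr rfl fun i _ => ?_
      rw [minimalPeriod_eq_of_forall (d := Function.minimalPeriod u i)]
      intro k
      rw [node_zero_pow, node_zero_apply_zero, minimalPeriod_dvd_iff]
      simp
    · refine Finset.sum_congr rfl fun i _ => ?_
      rw [minimalPeriod_eq_of_forall (d := Function.minimalPeriod v i)]
      intro k
      rw [node_zero_pow, node_zero_apply_one, minimalPeriod_dvd_iff]
      simp

theorem node_one_pow_two_mul (k : ℕ) :
    node u v 1 ^ (2 * k) = node ((u * v) ^ k) ((v * u) ^ k) 0 := by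
  rw [pow_mul, sq, node_one_mul_one, node_zero_pow]

theorem minimalPeriod_node_one_zero (i : Fin (2 ^ n)) :
    Function.minimalPeriod (node u v 1) (halves n (0, i)) =
      2 * Function.minimalPeriod (u * v : LeafPerm n) i := by
  refine minimalPeriod_eq_of_forall fun k => ?_
  obtain ⟨j, rfl | rfl⟩ := Nat.even_or_odd' k
  · rw [node_one_pow_two_mul, node_zero_apply_zero, Nat.mul_dvd_mul_iff_left (by norm_num),
      minimalPeriod_dvd_iff]
    simp
  · rw [add_comm (2 * j) 1, pow_add (node u v 1), pow_one, node_one_pow_two_mul, Equiv.Perm.mul_apply,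
      node_zero_apply_zero, node_one_apply_zero]
    have : ¬ 2 * Function.minimalPeriod (u * v : LeafPerm n) i ∣ 1 + 2 * j := fun h => by
      have := (Dvd.intro _ rfl).trans h
      omega
    refine iff_of_false (fun e => ?_) this
    simp at e

theorem minimalPeriod_node_one_one (i : Fin (2 ^ n)) :
    Function.minimalPeriod (node u v 1) (halves n (1, i)) =
      2 * Function.minimalPeriod (u * v : LeafPerm n) (u i) := by
  rw [← minimalPeriod_node_one_zero]
  refine minimalPeriod_eq_of_forall fun k => ?_
  rw [minimalPeriod_dvd_iff, ← node_one_apply_one u v, ← Equiv.Perm.mul_apply,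
    ← pow_succ (node u v 1), pow_succ' (node u v 1), Equiv.Perm.mul_apply, Equiv.apply_eq_iff_eq]

theorem cycleTypeFull_node_one :
    cycleTypeFull (node u v 1) = (cycleTypeFull (u * v)).map (2 * ·) := by
  refine parts_eq_of_periods (fun d hd => ?_) ?_
  · obtain ⟨e, he, rfl⟩ := Multiset.mem_map.1 hd
    have := cycleTypeFull_pos he
    omega
  · have h1 : ∑ i, ({2 * Function.minimalPeriod (u * v : LeafPerm n) i} : Multiset ℕ) =
        (periods (u * v)).map (2 * ·) := by
      rw [periods, ← Multiset.coe_mapAddMonoidHom, map_sum]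
      simp
    -- A cycle of length `d` of `u * v` is seen once from each half, giving `2 * d` points of period
    -- `2 * d`.
    have h2 : ∀ S : Multiset ℕ, (repeated S).map (2 * ·) + (repeated S).map (2 * ·) =
        repeated (S.map (2 * ·)) := fun S => by
      rw [repeated, repeated, Multiset.map_bind, Multiset.bind_map, ← Multiset.bind_add]
      refine Multiset.bind_congr fun d _ => ?_
      rw [Multiset.map_replicate, ← Multiset.replicate_add, two_mul]
    rw [periods, sum_halves]
    simp only [minimalPeriod_node_one_zero, minimalPeriod_node_one_one]
    rw [Equiv.sum_comp u fun i =>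
      ({2 * Function.minimalPeriod (u * v : LeafPerm n) i} : Multiset ℕ), h1,
      periods_eq_repeated_cycleTypeFull, h2]

end cycleTypeFull

/-! ## Averages over the elements of a given type -/

section average

open scoped Classical in
/-- The finite set of elements of `W_n` of type `(s, t)`. -/
noncomputable def fiber (n : ℕ) (s t : Fin 2) : Finset (LeafPerm n) :=
  Finset.univ.filter (· ∈ typeFiber n s t)

theorem mem_fiber {n : ℕ} {s t : Fin 2} {g : LeafPerm n} :
    g ∈ fiber n s t ↔ g ∈ typeFiber n s t := by simp [fiber]

open scoped Classical in
/-- The number of types of the identity. -/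
noncomputable def typeCount (n : ℕ) : ℕ :=
  (Finset.univ.filter fun T : Fin 2 × Fin 2 => 1 ∈ typeFiber n T.1 T.2).card

theorem fin_two_sub (s t : Fin 2) : s + t + t = s := by revert s t; decide

open scoped Classical in
-- The compatible types form a coset of the types of the identity. Their number, `typeCount n`,
-- measures how often a pair of sections is counted when summing over types.
theorem card_types_node {n : ℕ} (s t : Fin 2) (u v : LeafPerm n) :
    (Finset.univ.filter fun T : Fin 2 × Fin 2 =>
      u ∈ typeFiber n T.1 T.2 ∧ v ∈ typeFiber n (t + T.1) (s + T.2)).card =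
      if node u v s ∈ typeFiber (n + 1) s t then typeCount n else 0 := by
  split_ifs with h
  · obtain ⟨w, y, p, q, p', q', ht, hs, hu, hv, e⟩ := h
    obtain ⟨rfl, rfl, -⟩ := node_injective e
    obtain rfl : p' = t + p := by clear * - ht; revert p p' t; decide
    obtain rfl : q' = s + q := by clear * - hs; revert q q' s; decide
    refine Finset.card_equiv (Equiv.addRight (p, q)) fun T => ?_
    simp only [Finset.mem_filter, Finset.mem_univ, true_and, Equiv.coe_addRight, Prod.fst_add,
      Prod.snd_add]
    constructor
    · rintro ⟨h, -⟩
      have := mul_mem_typeFiber h (inv_mem_typeFiber hu)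
      rwa [mul_inv_cancel] at this
    · intro h
      have h1 := mul_mem_typeFiber h hu
      have h2 := mul_mem_typeFiber h hv
      rw [one_mul, fin_two_sub, fin_two_sub] at h1
      have e : ∀ a b c : Fin 2, a + b + (c + b) = c + a := by decide
      rw [one_mul, e, e] at h2
      exact ⟨h1, h2⟩
  · rw [Finset.card_eq_zero, Finset.filter_eq_empty_iff]
    rintro T - ⟨hu, hv⟩
    have e : ∀ a b : Fin 2, a + (b + a) = b := by decide
    exact h (node_mem_typeFiber hu hv (e _ _) (e _ _))

open scoped Classical in
theorem sum_fiber_succ {R : Type*} [AddCommMonoid R] {n : ℕ} (s t : Fin 2)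
    (f : LeafPerm (n + 1) → R) :
    ∑ T : Fin 2 × Fin 2, ∑ u ∈ fiber n T.1 T.2, ∑ v ∈ fiber n (t + T.1) (s + T.2), f (node u v s) =
      typeCount n • ∑ g ∈ fiber (n + 1) s t, f g := by
  have h1 : ∀ T : Fin 2 × Fin 2,
      ∑ u ∈ fiber n T.1 T.2, ∑ v ∈ fiber n (t + T.1) (s + T.2), f (node u v s) =
      ∑ p : LeafPerm n × LeafPerm n,
        if p.1 ∈ typeFiber n T.1 T.2 ∧ p.2 ∈ typeFiber n (t + T.1) (s + T.2) then
          f (node p.1 p.2 s) else 0 := by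
    intro T
    rw [← Finset.sum_product', ← Finset.sum_filter]
    refine Finset.sum_congr ?_ fun _ _ => rfl
    ext p
    simp [mem_fiber]
  have h2 : ∑ g ∈ fiber (n + 1) s t, f g = ∑ p : LeafPerm n × LeafPerm n,
      if node p.1 p.2 s ∈ typeFiber (n + 1) s t then f (node p.1 p.2 s) else 0 := by
    rw [← Finset.sum_filter]
    symm
    refine Finset.sum_bij (fun p _ => node p.1 p.2 s) ?_ ?_ ?_ fun _ _ => rfl
    · intro p hp
      simpa [mem_fiber] using hp
    · intro p _ p' _ e
      exact Prod.ext (node_injective e).1 (node_injective e).2.1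
    · intro g hg
      rw [mem_fiber] at hg
      obtain ⟨u, v, p, q, p', q', ht, hs, hu, hv, rfl⟩ := hg
      exact ⟨(u, v), by simpa using node_mem_typeFiber hu hv ht hs, rfl⟩
  rw [Finset.sum_congr rfl fun T _ => h1 T, Finset.sum_comm, h2, Finset.smul_sum]
  refine Finset.sum_congr rfl fun p _ => ?_
  rw [← Finset.sum_filter, Finset.sum_const, card_types_node]
  split_ifs <;> simp

theorem typeFiber_nonempty (n : ℕ) (s t : Fin 2) : ∃ g, g ∈ typeFiber n s t := by
  obtain rfl | rfl : s = 0 ∨ s = 1 := by clear * -; revert s; decide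
  · obtain rfl | rfl : t = 0 ∨ t = 1 := by clear * -; revert t; decide
    · exact ⟨1, one_mem_typeFiber n⟩
    · exact ⟨m n, m_mem_typeFiber n⟩
  · obtain rfl | rfl : t = 0 ∨ t = 1 := by clear * -; revert t; decide
    · exact ⟨mLeft n, mLeft_mem_typeFiber n⟩
    · exact ⟨x n n, x_mem_typeFiber n⟩

theorem sum_fiber_mul_left {R : Type*} [AddCommMonoid R] {n : ℕ} {s t : Fin 2} {g : LeafPerm n}
    (hg : g ∈ typeFiber n s t) (s' t' : Fin 2) (f : LeafPerm n → R) :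
    ∑ h ∈ fiber n s' t', f (g * h) = ∑ h ∈ fiber n (s + s') (t + t'), f h := by
  refine Finset.sum_bij (fun h _ => g * h) ?_ ?_ ?_ fun _ _ => rfl
  · intro h hh
    rw [mem_fiber] at hh ⊢
    exact mul_mem_typeFiber hg hh
  · intro h _ h' _ e
    exact mul_left_cancel e
  · intro h hh
    refine ⟨g⁻¹ * h, ?_, by simp⟩
    rw [mem_fiber] at hh ⊢
    have := mul_mem_typeFiber (inv_mem_typeFiber hg) hh
    have e : ∀ a b : Fin 2, a + (a + b) = b := by decide
    rwa [e, e] at this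

/-- The number of elements of `W_n` of any given type. -/
noncomputable def fiberCard (n : ℕ) : ℕ := (fiber n 0 0).card

theorem card_fiber (n : ℕ) (s t : Fin 2) : (fiber n s t).card = fiberCard n := by
  obtain ⟨g, hg⟩ := typeFiber_nonempty n s t
  have := sum_fiber_mul_left hg 0 0 fun _ => 1
  simpa [fiberCard] using this.symm

theorem fiberCard_pos (n : ℕ) : 0 < fiberCard n :=
  Finset.card_pos.2 ⟨1, mem_fiber.2 (one_mem_typeFiber n)⟩

theorem typeCount_mul_fiberCard (n : ℕ) :
    typeCount n * fiberCard (n + 1) = 4 * (fiberCard n * fiberCard n) := by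
  have := sum_fiber_succ (n := n) 0 0 fun _ => 1
  simpa [card_fiber] using this.symm

/-! ### Generating functions of cycle types. -/

/-- Rational combinations of cycle types. -/
abbrev CycleAlgebra := AddMonoidAlgebra ℚ (Multiset ℕ)

/-- The cycle type of `g` as an element of the algebra. -/
noncomputable def cycleMonomial {n : ℕ} (g : LeafPerm n) : CycleAlgebra :=
  AddMonoidAlgebra.single (cycleTypeFull g) 1

/-- The doubling of all cycle lengths. -/
noncomputable def doubling : CycleAlgebra →+* CycleAlgebra :=
  AddMonoidAlgebra.mapDomainRingHom ℚ (Multiset.mapAddMonoidHom (2 * ·))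

theorem cycleMonomial_node_zero {n : ℕ} (u v : LeafPerm n) :
    cycleMonomial (node u v 0) = cycleMonomial u * cycleMonomial v := by
  rw [cycleMonomial, cycleMonomial, cycleMonomial, AddMonoidAlgebra.single_mul_single,
    cycleTypeFull_node_zero, one_mul]

theorem doubling_single (c : Multiset ℕ) (r : ℚ) :
    doubling (AddMonoidAlgebra.single c r) = AddMonoidAlgebra.single (c.map (2 * ·)) r := by
  simp [doubling]

theorem cycleMonomial_node_one {n : ℕ} (u v : LeafPerm n) :
    cycleMonomial (node u v 1) = doubling (cycleMonomial (u * v)) := by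
  rw [cycleMonomial, cycleMonomial, doubling_single, cycleTypeFull_node_one]

/-- The average cycle type of the elements of `W_n` of type `(s, t)`. -/
noncomputable def average (n : ℕ) (s t : Fin 2) : CycleAlgebra :=
  (fiberCard n : ℚ)⁻¹ • ∑ g ∈ fiber n s t, cycleMonomial g

theorem doubling_smul (r : ℚ) (y : CycleAlgebra) : doubling (r • y) = r • doubling y :=
  map_rat_smul doubling r y

theorem average_succ_eq {n : ℕ} (s t : Fin 2) :
    average (n + 1) s t = ((4 : ℚ)⁻¹ * ((fiberCard n : ℚ)⁻¹ * (fiberCard n : ℚ)⁻¹)) •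
      ∑ T : Fin 2 × Fin 2, ∑ u ∈ fiber n T.1 T.2, ∑ v ∈ fiber n (t + T.1) (s + T.2),
        cycleMonomial (node u v s) := by
  have h1 : (typeCount n : ℚ) * fiberCard (n + 1) = 4 * (fiberCard n * fiberCard n) := by
    exact_mod_cast typeCount_mul_fiberCard n
  have h2 : (fiberCard n : ℚ) ≠ 0 := by exact_mod_cast (fiberCard_pos n).ne'
  have h3 : (fiberCard (n + 1) : ℚ) ≠ 0 := by exact_mod_cast (fiberCard_pos (n + 1)).ne'
  rw [sum_fiber_succ, average, ← Nat.cast_smul_eq_nsmul ℚ, smul_smul]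
  congr 1
  field_simp
  linarith

theorem average_succ_zero (n : ℕ) (t : Fin 2) :
    average (n + 1) 0 t =
      (4 : ℚ)⁻¹ • ∑ T : Fin 2 × Fin 2, average n T.1 T.2 * average n (t + T.1) T.2 := by
  rw [average_succ_eq, mul_smul, Finset.smul_sum]
  congr 1
  refine Finset.sum_congr rfl fun T _ => ?_
  simp only [cycleMonomial_node_zero, zero_add]
  rw [average, average, smul_mul_smul_comm, Finset.sum_mul_sum]

/-- For each fixed `u`, left multiplication makes `u * v` run uniformly through the fiber of type
`(t, 1)`, so the four values of `T` contribute equally. -/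
theorem average_succ_one (n : ℕ) (t : Fin 2) :
    average (n + 1) 1 t = doubling (average n t 1) := by
  have h2 : (fiberCard n : ℚ) ≠ 0 := by exact_mod_cast (fiberCard_pos n).ne'
  have key : ∀ T : Fin 2 × Fin 2, ∑ u ∈ fiber n T.1 T.2, ∑ v ∈ fiber n (t + T.1) (1 + T.2),
      cycleMonomial (node u v 1) =
      (fiberCard n : ℚ) • doubling (∑ g ∈ fiber n t 1, cycleMonomial g) := by
    intro T
    rw [← card_fiber n T.1 T.2, Nat.cast_smul_eq_nsmul, ← Finset.sum_const]
    refine Finset.sum_congr rfl fun u hu => ?_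
    simp only [cycleMonomial_node_one]
    rw [sum_fiber_mul_left (mem_fiber.1 hu) _ _ fun g => doubling (cycleMonomial g), map_sum]
    have e : ∀ a b : Fin 2, a + (b + a) = b := by decide
    rw [e, e]
  rw [average_succ_eq, Finset.sum_congr rfl fun T _ => key T, average, doubling_smul,
    Finset.sum_const, ← Nat.cast_smul_eq_nsmul ℚ, smul_smul, smul_smul]
  congr 1
  simp
  field_simp

theorem average_zero (s t : Fin 2) : average 0 s t = AddMonoidAlgebra.single {1} 1 := by
  have h : ∀ s t, fiber 0 s t = {1} := fun s t => by
    ext g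
    rw [mem_fiber, Finset.mem_singleton]
    rfl
  have h1 : cycleTypeFull (1 : LeafPerm 0) = {1} := by
    refine parts_eq_of_periods (by simp) ?_
    simp [periods, repeated]
  rw [average, fiberCard, h, h, Finset.sum_singleton, cycleMonomial, h1]
  simp

theorem coeff_cycleMonomial_sum {n : ℕ} (s : Finset (LeafPerm n)) (c : Multiset ℕ) :
    (∑ g ∈ s, cycleMonomial g).coeff c = ((s.filter fun g => cycleTypeFull g = c).card : ℚ) := by
  classical
  rw [Finset.card_filter]
  simp [cycleMonomial, Finsupp.single_apply]

theorem groupCycleDensity_M2 (n : ℕ) (c : Multiset ℕ) :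
    groupCycleDensity (M2 (n + 1)) c =
      ((2 : ℚ)⁻¹ • (average (n + 1) 0 0 + average (n + 1) 1 0)).coeff c := by
  classical
  have hmem : ∀ g, g ∈ M2 (n + 1) ↔ g ∈ fiber (n + 1) 0 0 ∪ fiber (n + 1) 1 0 := by
    intro g
    rw [M2_eq_evenTypedGroup, mem_evenTypedGroup, Finset.mem_union, mem_fiber, mem_fiber]
    exact ⟨fun ⟨s, hs⟩ => by
      obtain rfl | rfl : s = 0 ∨ s = 1 := by clear * -; revert s; decide
      exacts [Or.inl hs, Or.inr hs], fun h => h.elim (fun h => ⟨_, h⟩) fun h => ⟨_, h⟩⟩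
  have hdis : Disjoint (fiber (n + 1) 0 0) (fiber (n + 1) 1 0) := by
    rw [Finset.disjoint_left]
    intro g h0 h1
    exact absurd (typeFiber_fst_unique (mem_fiber.1 h0) (mem_fiber.1 h1)) (by decide)
  have h1 : Nat.card (M2 (n + 1)) = 2 * fiberCard (n + 1) := by
    rw [two_mul]
    nth_rewrite 1 [← card_fiber (n + 1) 0 0]
    rw [← card_fiber (n + 1) 1 0, ← Finset.card_union_of_disjoint hdis]
    exact Nat.subtype_card _ fun g => (hmem g).symm
  have h2 : Nat.card {g : LeafPerm (n + 1) // g ∈ M2 (n + 1) ∧ cycleTypeFull g = c} =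
      ((fiber (n + 1) 0 0 ∪ fiber (n + 1) 1 0).filter fun g => cycleTypeFull g = c).card :=
    Nat.subtype_card _ fun g => by rw [Finset.mem_filter, ← hmem]
  rw [groupCycleDensity, h1, h2, average, average, ← smul_add, ← Finset.sum_union hdis, smul_smul,
    AddMonoidAlgebra.coeff_smul, Finsupp.smul_apply, coeff_cycleMonomial_sum]
  push_cast
  rw [smul_eq_mul, div_eq_mul_inv, mul_inv, mul_comm]

end average

open Polynomial

/-! ## The Markov process through generating functions -/

/-- The collection of data as a combination of cycle types. -/
noncomputable def genData (A : Data) : CycleAlgebra :=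
  (A.map fun D => AddMonoidAlgebra.single (degrees D.1) D.2).sum

/-- The combination of cycle types that arises from one factor in `k` steps. -/
noncomputable def genFactor (f : ℤ[X]) : ℕ → Typ × ℕ → CycleAlgebra
  | 0, g => AddMonoidAlgebra.single {g.2} 1
  | k + 1, g => ((childrenData f g).map fun C => C.2 • (C.1.map (genFactor f k)).prod).sum

theorem coeff_genData (A : Data) (c : Multiset ℕ) : (genData A).coeff c = cycleDensity A c := by
  induction A with
  | nil => simp [genData, cycleDensity]
  | cons D A ih =>
    rw [genData, List.map_cons, List.sum_cons, ← genData, AddMonoidAlgebra.coeff_add,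
      Finsupp.add_apply, ih, cycleDensity, cycleDensity, List.filter_cons]
    by_cases h : degrees D.1 = c <;> simp [h]

theorem genFactor_zero_prod (f : ℤ[X]) (D : FactorizationType) :
    (D.map (genFactor f 0)).prod = AddMonoidAlgebra.single (degrees D) 1 := by
  induction D with
  | nil => rfl
  | cons g D ih =>
    rw [List.map_cons, List.prod_cons, ih, genFactor, AddMonoidAlgebra.single_mul_single, one_mul]
    rfl

theorem sum_map_flatMap {α β R : Type*} [AddMonoid R] (l : List α) (F : α → List β) (G : β → R) :
    ((l.flatMap F).map G).sum = (l.map fun i => ((F i).map G).sum).sum := by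
  induction l with
  | nil => simp
  | cons i l ih => simp [ih]

theorem sum_stepType (f : ℤ[X]) (k : ℕ) (D : FactorizationType) :
    ((stepType f D).map fun E => E.2 • (E.1.map (genFactor f k)).prod).sum =
      (D.map (genFactor f (k + 1))).prod := by
  induction D with
  | nil => simp [stepType]
  | cons g D ih =>
    rw [stepType, sum_map_flatMap, List.map_cons, List.prod_cons, ← ih, genFactor,
      ← List.sum_map_mul_right]
    congr 1
    refine List.map_congr_left fun C _ => ?_
    rw [← List.sum_map_mul_left, List.map_map]
    congr 1
    refine List.map_congr_left fun E _ => ?_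
    simp only [Function.comp_apply, List.map_append, List.prod_append, smul_mul_smul_comm]

/-- Factors evolve independently, so the contribution of a formal product is the product of the
contributions of its factors. -/
theorem genData_iterate (f : ℤ[X]) (k : ℕ) (A : Data) :
    genData ((stepData f)^[k] A) = (A.map fun D => D.2 • (D.1.map (genFactor f k)).prod).sum := by
  induction k generalizing A with
  | zero =>
    rw [Function.iterate_zero, id, genData]
    congr 1
    refine List.map_congr_left fun D _ => ?_
    rw [genFactor_zero_prod]
    simp
  | succ k ih =>
    rw [Function.iterate_succ_apply, ih, stepData, sum_map_flatMap]
    congr 1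
    refine List.map_congr_left fun D _ => ?_
    rw [← sum_stepType, List.map_map, List.smul_sum, List.map_map]
    congr 1
    refine List.map_congr_left fun E _ => ?_
    simp [mul_smul]

/-! ## The critical orbit of `h_a` -/

theorem aeval_h (a : ℤ) (y : ℚ) : aeval y (h a) = (y + a) ^ 2 - a - 1 := by
  simp [h]

theorem criticalPoint_h (a : ℤ) : criticalPoint (h a) = -a := by
  have e : h a = C 1 * X ^ 2 + C (2 * a) * X + C (a ^ 2 - a - 1) := by
    simp only [h, map_mul, map_sub, map_pow, map_one, map_ofNat]
    ring
  generalize h3 : a ^ 2 - a - 1 = c at e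
  generalize h4 : 2 * a = b at e
  have h1 : (h a).coeff 1 = 2 * a := by rw [e, h4]; simp [-eq_intCast, -map_intCast, coeff_C]
  have h2 : (h a).coeff 2 = 1 := by rw [e]; simp [-eq_intCast, -map_intCast]
  rw [criticalPoint, h1, h2]
  push_cast
  ring

theorem criticalIterate_h (a : ℤ) (k : ℕ) :
    criticalIterate (h a) k = if Even k then -(a : ℚ) else -a - 1 := by
  induction k with
  | zero => simp [criticalIterate, criticalPoint_h]
  | succ k ih =>
    rw [criticalIterate, Function.iterate_succ_apply', ← criticalIterate, ih, aeval_h]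
    by_cases hk : Even k
    · simp [hk, Nat.even_add_one]
    · simp [hk, Nat.even_add_one]
      ring

theorem postCriticalOrbit_h (a : ℤ) : postCriticalOrbit (h a) = {-(a : ℚ) - 1, -(a : ℚ)} := by
  ext y
  simp only [postCriticalOrbit, Set.mem_ofPred_eq, criticalIterate_h, Set.mem_insert_iff,
    Set.mem_singleton_iff]
  constructor
  · rintro ⟨k, -, rfl⟩
    split_ifs <;> simp
  · rintro (rfl | rfl)
    · exact ⟨1, by norm_num, by simp⟩
    · exact ⟨2, by norm_num, by simp⟩

theorem orbitSize_h (a : ℤ) : orbitSize (h a) = 2 := by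
  rw [orbitSize, postCriticalOrbit_h, Set.ncard_pair]
  intro h
  linarith

theorem tailSize_h (a : ℤ) : tailSize (h a) = 0 := by
  have : postCriticalTail (h a) = ∅ := by
    rw [Set.eq_empty_iff_forall_notMem]
    rintro y ⟨k, -, -, hk⟩
    refine hk (k + 2) (by omega) ?_
    simp [criticalIterate_h, Nat.even_add]
  rw [tailSize, this, Set.ncard_empty]

theorem siblingIndex_h (a : ℤ) : siblingIndex (h a) = 2 := by
  rw [siblingIndex, if_pos (tailSize_h a), orbitSize_h]

theorem returnIndex_h (a : ℤ) : returnIndex (h a) = 1 := by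
  rw [returnIndex, orbitSize_h]
  refine le_antisymm (Nat.sInf_le ⟨le_rfl, ?_⟩) (le_csInf ⟨1, le_rfl, ?_⟩ fun k hk => hk.1)
  all_goals simp [criticalIterate_h, Nat.even_add_one]

theorem actTyp_h (a : ℤ) (T : Typ) : actTyp (h a) T = T.tail ++ [digit T 1] := by
  rw [actTyp, returnIndex_h]

theorem allowablePairs_h (a : ℤ) (T : Typ) : allowablePairs (h a) T =
    ((allTypes 2).product (allTypes 2)).filter fun P =>
      mulTyp P.1 P.2 = T.tail ++ [digit T 1] ∧ digit P.1 2 = digit P.2 2 ∧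
        digit P.2 2 = digit P.1 2 := by
  simp only [allowablePairs, orbitSize_h, siblingIndex_h, actTyp_h]

/-! ## Comparison of the process with the average cycle types -/

/-- The letter of an element of `ℤ/2`. -/
def toLetter (s : Fin 2) : Letter := if s = 0 then Letter.s else Letter.n

/-- The type given by two elements of `ℤ/2`. -/
def toTyp (s t : Fin 2) : Typ := [toLetter s, toLetter t]

/-- A pair of children is fixed by the type `T` of the first: equal last letters force the same
second entry, and the product condition gives the other first entry. Hence there are four options,
each with probability 1/4. -/
theorem childrenData_zero (a : ℤ) (t : Fin 2) (d : ℕ) : (childrenData (h a) (toTyp 0 t, d)).Perm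
    ([(0, 0), (0, 1), (1, 0), (1, 1)].map fun T : Fin 2 × Fin 2 =>
      ([(toTyp T.1 T.2, d), (toTyp (t + T.1) T.2, d)], 1 / 4)) := by
  have key : (allowablePairs (h a) (toTyp 0 t)).Perm
      ([(0, 0), (0, 1), (1, 0), (1, 1)].map fun T : Fin 2 × Fin 2 =>
        (toTyp T.1 T.2, toTyp (t + T.1) T.2)) := by
    rw [allowablePairs_h]
    revert t
    decide
  have hopt : childrenOptions (h a) (toTyp 0 t, d) =
      (allowablePairs (h a) (toTyp 0 t)).map fun P => [(P.1, d), (P.2, d)] := rfl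
  rw [childrenData, hopt, List.length_map, key.length_eq, List.map_map]
  refine (key.map _).trans (List.Perm.of_eq ?_)
  rw [List.map_map]
  norm_num [Function.comp_def]

theorem genFactor_succ_zero (a : ℤ) (k : ℕ) (t : Fin 2) (d : ℕ) :
    genFactor (h a) (k + 1) (toTyp 0 t, d) = (4 : ℚ)⁻¹ • ∑ T : Fin 2 × Fin 2,
      genFactor (h a) k (toTyp T.1 T.2, d) * genFactor (h a) k (toTyp (t + T.1) T.2, d) := by
  rw [genFactor, ((childrenData_zero a t d).map _).sum_eq, Fintype.sum_prod_type, Fin.sum_univ_two,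
    Fin.sum_univ_two, Fin.sum_univ_two]
  simp [smul_add]
  abel

theorem genFactor_succ_one (a : ℤ) (k : ℕ) (t : Fin 2) (d : ℕ) :
    genFactor (h a) (k + 1) (toTyp 1 t, d) = genFactor (h a) k (toTyp t 1, 2 * d) := by
  have hopt : childrenOptions (h a) (toTyp 1 t, d) = [[(actTyp (h a) (toTyp 1 t), 2 * d)]] := rfl
  rw [genFactor, childrenData, hopt, actTyp_h]
  simp [toTyp, digit]

theorem genFactor_two_mul (a : ℤ) (k : ℕ) (s t : Fin 2) (d : ℕ) :
    genFactor (h a) k (toTyp s t, 2 * d) = doubling (genFactor (h a) k (toTyp s t, d)) := by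
  induction k generalizing s t d with
  | zero => rw [genFactor, genFactor, doubling_single, Multiset.map_singleton]
  | succ k ih =>
    obtain rfl | rfl : s = 0 ∨ s = 1 := by clear * -; revert s; decide
    · simp only [genFactor_succ_zero, doubling_smul, map_sum, map_mul, ih]
    · rw [genFactor_succ_one, genFactor_succ_one, ih]

theorem genFactor_eq_average (a : ℤ) (k : ℕ) (s t : Fin 2) :
    genFactor (h a) k (toTyp s t, 1) = average k s t := by
  induction k generalizing s t with
  | zero => rw [genFactor, average_zero]
  | succ k ih =>
    obtain rfl | rfl : s = 0 ∨ s = 1 := by clear * -; revert s; decide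
    · simp only [genFactor_succ_zero, average_succ_zero, ih]
    · rw [genFactor_succ_one, average_succ_one, genFactor_two_mul, ih]

/-- One step turns `[ns,1]` into `[sn,2]` and `[ss,1]` into the four pairs of equal types with
probability 1/4 each; halving gives the densities 1/2 and 1/8 of `model6`. -/
theorem genData_model6 (a : ℤ) (k : ℕ) : genData (levelData (h a) model6 (k + 1)) =
    (2 : ℚ)⁻¹ • (average (k + 1) 0 0 + average (k + 1) 1 0) := by
  rw [levelData, Nat.add_sub_cancel, genData_iterate, average_succ_zero, average_succ_one]
  simp only [← genFactor_eq_average a k, ← genFactor_two_mul, Fintype.sum_prod_type,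
    Fin.sum_univ_two, zero_add, mul_one]
  simp only [model6, toTyp, toLetter, List.map_cons, List.map_nil, List.prod_cons, List.prod_nil,
    List.sum_cons, List.sum_nil, mul_one, smul_add, smul_smul, if_true, one_ne_zero, if_false]
  norm_num
  abel

end MarkovModel

theorem corollary6p28 (a : ℤ) (ha : ∃ b : ℤ, a = b ^ 2 ∨ a = -b ^ 2)
    (hirr : Irreducible (MarkovModel.h a)) (n : ℕ) (hn : 1 ≤ n) :
    MarkovModel.SatisfiesEvenMarkovModel (MarkovModel.h a) MarkovModel.model6 n
      (MarkovModel.M2 n) := by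
  obtain ⟨k, rfl⟩ := Nat.exists_eq_add_of_le' hn
  refine ⟨fun g hg => ?_, fun c => ?_⟩
  · rw [MarkovModel.M2_eq_evenTypedGroup] at hg
    obtain ⟨s, hs⟩ := hg
    exact MarkovModel.typeFiber_subset_treeAut hs
  · rw [MarkovModel.groupCycleDensity_M2, ← MarkovModel.coeff_genData, MarkovModel.genData_model6]
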